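/- Let $M$ be a von Neumann algebra with a faithful normal tracial state $\tau$, and let $L^p(M)=L^p(M,\tau)$ $(p=1,2)$ be the completion of $M$ in the norm $\tau(|x|^p)^{1/p}$. Products $x^*y\in L^1(M)$ of $x,y\in L^2(M)$ and $xa\in L^2(M)$ of $x\in L^2(M)$, $a\in M$ are the usual ones. Let $A$ be a tracial subalgebra of $M$: a weak* closed unital subalgebra such that the faithful normal conditional expectation $\Phi$ of $M$ onto $\mathcal D:=A\cap A^*$ with $\tau\circ\Phi=\tau$ is multiplicative on $A$. Put $A_0=A\cap\operatorname{Ker}\Phi$, and let $L^1(\mathcal D)$ be the closure of $\mathcal D$ in $L^1(M)$. For a subspace $X\subset L^2(M)$ and $S\subset M$, let $[XS]_2$ be the closed linear span in $L^2(M)$ of $\{xa: x\in X,\ a\in S\}$. A (right $A$-)invariant subspace is a closed subspace $K$ of $L^2(M)$ with $KA\subset K$; it is simply invariant if $[KA_0]_2\subsetneq K$; its right wandering subspace is $K\ominus[KA_0]_2$; it is of type 2 if its right wandering subspace is $(0)$. A subspace $X$ of $L^2(M)$ is the column sum $X_1\oplus^{col}X_2$ of subspaces $X_1,X_2$ of $X$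 if $X_1+X_2$ is dense in $X$ and $X_1^*X_2=X_2^*X_1=\{0\}$. Say that $(Z,Y)$ is a decomposition of a subspace $X$ of $L^2(M)$ if $Z,Y$ are closed subspaces of $X$, $Z$ is a type 2 invariant subspace, $y^*x\in L^1(\mathcal D)$ for all $x,y\in Y$, and $X=Z\oplus^{col}[YA]_2$. Then: 1. If $(Z,Y)$ is a decomposition of $X$, then $X$ is simply invariant if and only if $Y\neq\{0\}$. 2. If $(Z,Y)$ is a decomposition of $X$, then $[Y\mathcal D]_2=X\ominus[XA_0]_2$, and $X=[XA_0]_2\oplus[Y\mathcal D]_2$ (orthogonal sum). 3. If $(Z,Y)$ is a decomposition of $X$, then so is $(Z,[Y\mathcal D]_2)$, and $[Y\mathcal D]_2$ is a right $\mathcal D$-submodule of $X$. 4. If $(Z,Y)$ and $(Z',Y')$ are decompositions of the same $X$, then $Z=Z'$ and $[Y\mathcal D]_2=[Y'\mathcal D]_2$; if moreover $Y$ and $Y'$ are right $\mathcal D$-submodules, then $Y=Y'$. 5. If $A$ is maximal subdiagonal (that is, $A+A^*$ is weak* dense in $M$), then for every right $A$-invariant subspace $X$ of $L^2(M)$ there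 is a $Z$ such that $(Z,Y)$ is a decomposition of $X$, where $Y=X\ominus[XA_0]_2$ is the right wandering subspace of $X$. -/

import Mathlib

open scoped ComplexOrder InnerProductSpace Topology

noncomputable section

/-! ### Noncommutative `L¹` and `L²` spaces of a tracial state -/

/-- A faithful tracial state on a unital C⋆-algebra. -/
structure FaithfulTracialState (M : Type*) [CStarAlgebra M] [PartialOrder M] [StarOrderedRing M]
    extends M →ₚ[ℂ] ℂ where
  map_one' : toFun 1 = 1
  map_mul_comm' : ∀ x y : M, toFun (x * y) = toFun (y * x)
  faithful' : ∀ x : M, toFun (star x * x) = 0 → x = 0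

namespace FaithfulTracialState

section

variable {M : Type*} [CStarAlgebra M] [PartialOrder M] [StarOrderedRing M]
  (τ : FaithfulTracialState M)

/-- The trace as a positive linear functional. -/
abbrev tr : M →ₚ[ℂ] ℂ := τ.toPositiveLinearMap

theorem tr_one : τ.tr 1 = 1 := τ.map_one'

theorem tr_mul_comm (x y : M) : τ.tr (x * y) = τ.tr (y * x) := τ.map_mul_comm' x y

/-- `L²(M, τ)`: the Hilbert space completion of `M` for the inner product `τ(x⋆ y)`. -/
abbrev L2 : Type _ := τ.tr.GNS

/-- The embedding of `M`, with the norm `‖x‖₂ = τ(x⋆ x)^{1/2}`, into its completion. -/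
def coeL2 : τ.tr.PreGNS →L[ℂ] τ.L2 := UniformSpace.Completion.toComplL

/-- The canonical map `M → L²(M, τ)`. -/
def toL2 : M →ₗ[ℂ] τ.L2 := τ.coeL2.toLinearMap ∘ₗ τ.tr.toPreGNS.toLinearMap

/-- `‖x‖₁ = τ(|x|)`. -/
def norm1 (x : M) : ℝ := (τ.tr (CFC.abs x)).re

theorem norm_tr_mul_le_two (x y : M) :
    ‖τ.tr (star x * y)‖ ≤ ‖τ.tr.toPreGNS x‖ * ‖τ.tr.toPreGNS y‖ := by
  have := norm_inner_le_norm (𝕜 := ℂ) (τ.tr.toPreGNS x) (τ.tr.toPreGNS y)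
  simpa [PositiveLinearMap.preGNS_inner_def] using this

theorem norm_two_mul_left_le (a x : M) :
    ‖τ.tr.toPreGNS (a * x)‖ ≤ ‖a‖ * ‖τ.tr.toPreGNS x‖ := by
  have h := (τ.tr.leftMulMapPreGNS a).le_opNorm (τ.tr.toPreGNS x)
  have h2 : ‖τ.tr.leftMulMapPreGNS a‖ ≤ ‖a‖ :=
    LinearMap.mkContinuous_norm_le _ (norm_nonneg _) _
  refine le_trans (le_of_eq ?_) (h.trans (mul_le_mul_of_nonneg_right h2 (norm_nonneg _)))
  simp

theorem norm_two_star (x : M) : ‖τ.tr.toPreGNS (star x)‖ = ‖τ.tr.toPreGNS x‖ := by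
  rw [PositiveLinearMap.preGNS_norm_def, PositiveLinearMap.preGNS_norm_def]
  simp only [PositiveLinearMap.ofPreGNS_toPreGNS, star_star]
  rw [τ.tr_mul_comm]

theorem norm_two_mul_right_le (x a : M) :
    ‖τ.tr.toPreGNS (x * a)‖ ≤ ‖a‖ * ‖τ.tr.toPreGNS x‖ := by
  rw [← τ.norm_two_star (x * a), star_mul, ← τ.norm_two_star x, ← norm_star a]
  exact τ.norm_two_mul_left_le _ _

theorem norm1_nonneg (x : M) : 0 ≤ τ.norm1 x :=
  (Complex.nonneg_iff.mp (τ.tr.map_nonneg (CFC.abs_nonneg x))).1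

theorem continuousOn_inv_add {z : M} {ε : ℝ} (hε : 0 < ε) :
    ContinuousOn (fun t : ℝ => (t + ε)⁻¹) (spectrum ℝ (CFC.abs z)) :=
  (continuous_id.add continuous_const).continuousOn.inv₀ fun _ ht =>
    (add_pos_of_nonneg_of_pos (spectrum_nonneg_of_nonneg (CFC.abs_nonneg z) ht) hε).ne'

/-- `z g(|z|)` is a contraction for `g(t) = (t + ε)⁻¹`. -/
theorem norm_mul_cfc_abs_le (z : M) {ε : ℝ} (hε : 0 < ε) :
    ‖z * cfc (fun t : ℝ => (t + ε)⁻¹) (CFC.abs z)‖ ≤ 1 := by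
  set p := CFC.abs z with hp
  have hp0 : 0 ≤ p := CFC.abs_nonneg z
  set g : ℝ → ℝ := fun t => (t + ε)⁻¹ with hg
  have hgc : ContinuousOn g (spectrum ℝ p) := continuousOn_inv_add hε
  have hsa : IsSelfAdjoint (cfc g p) := cfc_predicate g p
  have key : star (z * cfc g p) * (z * cfc g p) = cfc (fun t => g t * (t * t * g t)) p := by
    rw [cfc_mul g (fun t => t * t * g t) p hgc (by fun_prop),
      cfc_mul (fun t => t * t) g p (by fun_prop) hgc,
      cfc_mul (fun t : ℝ => t) (fun t => t) p (by fun_prop) (by fun_prop), cfc_id' ℝ p,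
      show p * p = star z * z from CFC.abs_mul_abs z, star_mul, hsa.star_eq]
    simp only [mul_assoc]
  have h1 : ‖cfc (fun t => g t * (t * t * g t)) p‖ ≤ 1 := by
    refine norm_cfc_le zero_le_one fun t ht => ?_
    have ht0 : 0 ≤ t := spectrum_nonneg_of_nonneg hp0 ht
    have hb : t * g t ≤ 1 := by
      rw [hg, ← div_eq_mul_inv]
      exact (div_le_one (by positivity)).2 (by linarith)
    have hb0 : 0 ≤ t * g t := mul_nonneg ht0 (inv_nonneg.2 (by linarith))
    rw [Real.norm_eq_abs, show g t * (t * t * g t) = (t * g t) * (t * g t) by ring,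
      abs_of_nonneg (mul_nonneg hb0 hb0)]
    nlinarith
  rw [← key, CStarRing.norm_star_mul_self] at h1
  nlinarith [norm_nonneg (z * cfc g p)]

/-- `‖z‖₁` is approximated by the values `|τ(z a)|` with `a` in the unit ball. -/
theorem exists_norm1_le (z : M) {ε : ℝ} (hε : 0 < ε) :
    ∃ a : M, ‖a‖ ≤ 1 ∧ τ.norm1 z ≤ ‖τ.tr (z * a)‖ + ε := by
  have hp0 : 0 ≤ CFC.abs z := CFC.abs_nonneg z
  have hgc : ContinuousOn (fun t : ℝ => (t + ε)⁻¹) (spectrum ℝ (CFC.abs z)) :=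
    continuousOn_inv_add hε
  have hsa : IsSelfAdjoint (cfc (fun t : ℝ => (t + ε)⁻¹) (CFC.abs z)) := cfc_predicate _ _
  refine ⟨star (z * cfc (fun t : ℝ => (t + ε)⁻¹) (CFC.abs z)), ?_, ?_⟩
  · rw [norm_star]; exact norm_mul_cfc_abs_le z hε
  have e1 : τ.tr (z * star (z * cfc (fun t : ℝ => (t + ε)⁻¹) (CFC.abs z)))
      = τ.tr (cfc (fun t : ℝ => (t + ε)⁻¹ * (t * t)) (CFC.abs z)) := by
    rw [τ.tr_mul_comm, star_mul, hsa.star_eq, mul_assoc, ← CFC.abs_mul_abs,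
      cfc_mul _ (fun t : ℝ => t * t) _ hgc (by fun_prop),
      cfc_mul (fun t : ℝ => t) (fun t => t) _ (by fun_prop) (by fun_prop), cfc_id' ℝ (CFC.abs z)]
  have e2 : CFC.abs z ≤ cfc (fun t : ℝ => (t + ε)⁻¹ * (t * t)) (CFC.abs z)
      + algebraMap ℝ M ε := by
    rw [← cfc_const ε (CFC.abs z), ← cfc_add (CFC.abs z) (hf := by fun_prop) (hg := by fun_prop)]
    conv_lhs => rw [← cfc_id' ℝ (CFC.abs z)]
    refine cfc_mono (fun t ht => ?_) (by fun_prop) (by fun_prop)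
    have ht0 : 0 ≤ t := spectrum_nonneg_of_nonneg hp0 ht
    have : 0 < t + ε := by linarith
    rw [← sub_nonneg, show (t + ε)⁻¹ * (t * t) + ε - t = ε * ε * (t + ε)⁻¹ by field_simp; ring]
    positivity
  have e3 : τ.tr (CFC.abs z) ≤ τ.tr (cfc (fun t : ℝ => (t + ε)⁻¹ * (t * t)) (CFC.abs z)) + ε := by
    have := OrderHomClass.mono τ.tr e2
    rwa [map_add, Algebra.algebraMap_eq_smul_one, ← Complex.coe_smul, map_smul, τ.tr_one,
      smul_eq_mul, mul_one] at this
  rw [e1, norm1]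
  have e4 := (Complex.le_def.1 e3).1
  rw [Complex.add_re, Complex.ofReal_re] at e4
  exact e4.trans (by gcongr; exact Complex.re_le_norm _)

/-- `|τ(z a)| ≤ ‖a‖ ‖z‖₁`. -/
theorem norm_tr_mul_le_norm1 (z a : M) : ‖τ.tr (z * a)‖ ≤ ‖a‖ * τ.norm1 z := by
  have main : ∀ ε : ℝ, 0 < ε → ‖τ.tr (z * a)‖ ≤ ‖a‖ * (τ.norm1 z + ε) := by
    intro ε hε
    have hp0 : 0 ≤ CFC.abs z := CFC.abs_nonneg z
    have hgc : ContinuousOn (fun t : ℝ => (t + ε)⁻¹) (spectrum ℝ (CFC.abs z)) :=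
      continuousOn_inv_add hε
    have hb := norm_mul_cfc_abs_le z hε
    set b := z * cfc (fun t : ℝ => (t + ε)⁻¹) (CFC.abs z) with hbdef
    set s := cfc (fun t : ℝ => √(t + ε)) (CFC.abs z) with hsdef
    have hsa : star s = s := (cfc_predicate _ _ : IsSelfAdjoint s).star_eq
    have hss : s * s = CFC.abs z + algebraMap ℝ M ε := by
      calc s * s = cfc (fun t : ℝ => √(t + ε) * √(t + ε)) (CFC.abs z) :=
            (cfc_mul _ _ _ (by fun_prop) (by fun_prop)).symm
        _ = cfc (fun t : ℝ => t + ε) (CFC.abs z) := by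
            refine cfc_congr fun t ht => ?_
            have ht0 : 0 ≤ t := spectrum_nonneg_of_nonneg hp0 ht
            exact Real.mul_self_sqrt (by linarith)
        _ = CFC.abs z + algebraMap ℝ M ε := by
            rw [cfc_add (CFC.abs z) (fun t : ℝ => t) (fun _ => ε), cfc_id' ℝ (CFC.abs z),
              cfc_const ε (CFC.abs z)]
    have hinv : cfc (fun t : ℝ => (t + ε)⁻¹) (CFC.abs z) * (s * s) = 1 := by
      rw [hss, ← cfc_const ε (CFC.abs z)]
      nth_rewrite 2 [← cfc_id' ℝ (CFC.abs z)]
      rw [← cfc_add (CFC.abs z) (fun t : ℝ => t) (fun _ => ε),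
        ← cfc_mul _ _ _ hgc (by fun_prop), ← cfc_const_one ℝ (CFC.abs z)]
      refine cfc_congr fun t ht => ?_
      have ht0 : 0 ≤ t := spectrum_nonneg_of_nonneg hp0 ht
      exact inv_mul_cancel₀ (by linarith)
    have hz : z = b * (s * s) := by
      rw [hbdef, mul_assoc, hinv, mul_one]
    have e1 : τ.tr (z * a) = τ.tr (star s * (a * b * s)) := by
      rw [hz, hsa, τ.tr_mul_comm s, τ.tr_mul_comm]
      simp only [mul_assoc]
    have e2 : ‖τ.tr.toPreGNS s‖ * ‖τ.tr.toPreGNS s‖ = τ.norm1 z + ε := by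
      have h := τ.tr.preGNS_norm_sq (τ.tr.toPreGNS s)
      rw [PositiveLinearMap.ofPreGNS_toPreGNS, hsa, hss, map_add,
        Algebra.algebraMap_eq_smul_one, ← Complex.coe_smul, map_smul, τ.tr_one,
        smul_eq_mul, mul_one] at h
      have h' := congrArg Complex.re h
      rw [← Complex.ofReal_pow, Complex.ofReal_re, Complex.add_re, Complex.ofReal_re] at h'
      rw [← sq, h', norm1]
    rw [e1]
    calc _ ≤ ‖τ.tr.toPreGNS s‖ * ‖τ.tr.toPreGNS (a * b * s)‖ := τ.norm_tr_mul_le_two _ _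
      _ ≤ ‖τ.tr.toPreGNS s‖ * (‖a * b‖ * ‖τ.tr.toPreGNS s‖) := by
        gcongr; exact τ.norm_two_mul_left_le _ _
      _ = ‖a * b‖ * (τ.norm1 z + ε) := by rw [← e2]; ring
      _ ≤ ‖a‖ * (τ.norm1 z + ε) := by
        have : 0 ≤ τ.norm1 z + ε := by linarith [τ.norm1_nonneg z]
        gcongr
        exact (norm_mul_le _ _).trans (mul_le_of_le_one_right (norm_nonneg _) hb)
  refine le_of_forall_pos_le_add fun δ hδ => ?_
  have hpos : 0 < ‖a‖ + 1 := by positivity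
  refine (main (δ / (‖a‖ + 1)) (by positivity)).trans ?_
  rw [mul_add]
  gcongr
  rw [mul_div_assoc', div_le_iff₀ hpos]
  nlinarith

theorem norm1_add_le (x y : M) : τ.norm1 (x + y) ≤ τ.norm1 x + τ.norm1 y := by
  refine le_of_forall_pos_le_add fun ε hε => ?_
  obtain ⟨a, ha, h⟩ := τ.exists_norm1_le (x + y) hε
  refine h.trans (add_le_add_left ?_ ε)
  rw [add_mul, map_add]
  refine (norm_add_le _ _).trans (add_le_add ?_ ?_)
  · exact (τ.norm_tr_mul_le_norm1 x a).trans (mul_le_of_le_one_left (τ.norm1_nonneg x) ha)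
  · exact (τ.norm_tr_mul_le_norm1 y a).trans (mul_le_of_le_one_left (τ.norm1_nonneg y) ha)

theorem norm1_smul (c : ℂ) (x : M) : τ.norm1 (c • x) = ‖c‖ * τ.norm1 x := by
  rw [norm1, CFC.abs_smul, ← Complex.coe_smul, map_smul, smul_eq_mul, Complex.re_ofReal_mul, norm1]

/-- `‖x⋆ y‖₁ ≤ ‖x‖₂ ‖y‖₂`. -/
theorem norm1_star_mul_le (x y : M) :
    τ.norm1 (star x * y) ≤ ‖τ.tr.toPreGNS x‖ * ‖τ.tr.toPreGNS y‖ := by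
  refine le_of_forall_pos_le_add fun ε hε => ?_
  obtain ⟨a, ha, h⟩ := τ.exists_norm1_le (star x * y) hε
  refine h.trans (add_le_add_left ?_ ε)
  rw [mul_assoc]
  refine (τ.norm_tr_mul_le_two _ _).trans ?_
  gcongr
  exact (τ.norm_two_mul_right_le y a).trans (mul_le_of_le_one_left (norm_nonneg _) ha)

/-- The algebra `M` with the norm `‖x‖₁ = τ(|x|)`. -/
def PreL1 (_τ : FaithfulTracialState M) : Type _ := M

instance : AddCommGroup τ.PreL1 := inferInstanceAs (AddCommGroup M)
instance : Module ℂ τ.PreL1 := inferInstanceAs (Module ℂ M)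

/-- The identity map from `M` to `M` with the norm `‖x‖₁`. -/
def toPreL1 : M ≃ₗ[ℂ] τ.PreL1 := LinearEquiv.refl ℂ _

/-- `‖x‖₁` as a seminorm. -/
def seminorm1 : Seminorm ℂ τ.PreL1 :=
  Seminorm.of (fun x => τ.norm1 (τ.toPreL1.symm x))
    (fun x y => by simpa using τ.norm1_add_le (τ.toPreL1.symm x) (τ.toPreL1.symm y))
    (fun c x => by simpa using τ.norm1_smul c (τ.toPreL1.symm x))

instance : SeminormedAddCommGroup τ.PreL1 := τ.seminorm1.toSeminormedAddCommGroup

instance : NormedSpace ℂ τ.PreL1 where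
  norm_smul_le c x := (map_smul_eq_mul τ.seminorm1 c x).le

theorem norm_toPreL1 (x : M) : ‖τ.toPreL1 x‖ = (τ.tr (CFC.abs x)).re := rfl

/-- `L¹(M, τ)`: the completion of `M` for the norm `τ(|x|)`. -/
abbrev L1 : Type _ := UniformSpace.Completion τ.PreL1

/-- The canonical map `M → L¹(M, τ)`. -/
def toL1 : M →ₗ[ℂ] τ.L1 :=
  (UniformSpace.Completion.toComplL (𝕜 := ℂ) (E := τ.PreL1)).toLinearMap ∘ₗ
    τ.toPreL1.toLinearMap

theorem norm_toL1 (x : M) : ‖τ.toL1 x‖ = τ.norm1 x :=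
  UniformSpace.Completion.norm_coe (τ.toPreL1 x)

/-- Right multiplication `x ↦ x a` on `M` with the norm `‖x‖₂`. -/
def preRightMul (a : M) : τ.tr.PreGNS →L[ℂ] τ.tr.PreGNS :=
  LinearMap.mkContinuous
    (τ.tr.toPreGNS.toLinearMap ∘ₗ LinearMap.mulRight ℂ a ∘ₗ τ.tr.ofPreGNS.toLinearMap) ‖a‖
    fun x => τ.norm_two_mul_right_le (τ.tr.ofPreGNS x) a

/-- Right multiplication `ξ ↦ ξ a` of elements of `L²(M)` by an element `a` of `M`: the continuous
extension of `x ↦ x a`. -/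
def rightMul (a : M) : τ.L2 →L[ℂ] τ.L2 := (τ.preRightMul a).completion

theorem rightMul_toL2 (a x : M) : τ.rightMul a (τ.toL2 x) = τ.toL2 (x * a) :=
  ContinuousLinearMap.completion_apply_coe (τ.preRightMul a) (τ.tr.toPreGNS x)

/-- The product `(x, y) ↦ x⋆ y`, from `M × M` with the norms `‖·‖₂` to `L¹(M)`. -/
def preStarMul : τ.tr.PreGNS →L⋆[ℂ] τ.tr.PreGNS →L[ℂ] τ.L1 :=
  LinearMap.mkContinuous₂
    (LinearMap.mk₂'ₛₗ (starRingEnd ℂ) (RingHom.id ℂ)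
      (fun x y => τ.toL1 (star (τ.tr.ofPreGNS x) * τ.tr.ofPreGNS y))
      (fun x x' y => by simp [add_mul])
      (fun c x y => by simp)
      (fun x y y' => by simp [mul_add])
      (fun c x y => by simp))
    1 fun x y => by
      rw [one_mul]
      exact (τ.norm_toL1 _).trans_le (τ.norm1_star_mul_le _ _)

/-- The product `(ξ, η) ↦ ξ⋆ η` from `L²(M) × L²(M)` to `L¹(M)`: the continuous extension of the
product `(x, y) ↦ x⋆ y` on `M`. -/
def starMul : τ.L2 →L⋆[ℂ] τ.L2 →L[ℂ] τ.L1 :=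
  ((τ.preStarMul.extend τ.coeL2).flip.extend τ.coeL2).flip

theorem denseRange_coeL2 : DenseRange τ.coeL2 := UniformSpace.Completion.denseRange_coe

theorem isUniformInducing_coeL2 : IsUniformInducing τ.coeL2 :=
  UniformSpace.Completion.isUniformInducing_coe _

theorem starMul_toL2 (x y : M) : τ.starMul (τ.toL2 x) (τ.toL2 y) = τ.toL1 (star x * y) := by
  have h1 := ContinuousLinearMap.extend_eq (τ.preStarMul.extend τ.coeL2).flip
    τ.denseRange_coeL2 τ.isUniformInducing_coeL2 (τ.tr.toPreGNS y)
  have h2 := ContinuousLinearMap.extend_eq τ.preStarMul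
    τ.denseRange_coeL2 τ.isUniformInducing_coeL2 (τ.tr.toPreGNS x)
  exact (congrArg (fun f => f (τ.toL2 x)) h1).trans (congrArg (fun f => f (τ.tr.toPreGNS y)) h2)

/-- `[X S]₂`: the closed linear span in `L²(M)` of the products `x a`, `x ∈ X`, `a ∈ S`. -/
def closedMul (X : Submodule ℂ τ.L2) (S : Set M) : Submodule ℂ τ.L2 :=
  (Submodule.span ℂ {ξ | ∃ x ∈ X, ∃ a ∈ S, τ.rightMul a x = ξ}).topologicalClosure

/-- `L¹(𝒟)` as a subspace of `L¹(M)`: the closure of `𝒟` in `L¹(M)`. -/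
def L1Of (D : Subalgebra ℂ M) : Submodule ℂ τ.L1 :=
  (D.toSubmodule.map τ.toL1).topologicalClosure

/-- `X` is the internal column sum of the subspaces `Xs i`: these are subspaces of `X` which
together densely span `X`, and `(Xs i)⋆ (Xs j) = 0` for `i ≠ j`. -/
structure IsColumnSum {ι : Type*} (X : Submodule ℂ τ.L2) (Xs : ι → Submodule ℂ τ.L2) : Prop where
  le : ∀ i, Xs i ≤ X
  dense : X ≤ (⨆ i, Xs i).topologicalClosure
  starMul_eq_zero : ∀ i j, i ≠ j → ∀ x ∈ Xs i, ∀ y ∈ Xs j, τ.starMul x y = 0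

end

end FaithfulTracialState

/-! ### Von Neumann algebras, weak⋆ topology, normality -/

namespace VonNeumannAlgebra

variable {H : Type*} [NormedAddCommGroup H] [InnerProductSpace ℂ H] [CompleteSpace H]

/-- The elements of a von Neumann algebra on `H`, as a C⋆-algebra (with its spectral order). -/
def Elem (M : VonNeumannAlgebra H) : Type _ := M.toStarSubalgebra

theorem isClosed_toStarSubalgebra (M : VonNeumannAlgebra H) :
    IsClosed (M.toStarSubalgebra : Set (H →L[ℂ] H)) := by
  rw [coe_toStarSubalgebra, ← M.centralizer_centralizer]
  exact Set.isClosed_centralizer _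

variable (M : VonNeumannAlgebra H)

instance : CStarAlgebra M.Elem :=
  haveI : IsClosed (M.toStarSubalgebra : Set (H →L[ℂ] H)) := M.isClosed_toStarSubalgebra
  inferInstanceAs (CStarAlgebra M.toStarSubalgebra)

instance : PartialOrder M.Elem := CStarAlgebra.spectralOrder M.Elem

instance : StarOrderedRing M.Elem := CStarAlgebra.spectralOrderedRing M.Elem

/-- The operator on `H` given by an element of `M`. -/
def Elem.toOp {M : VonNeumannAlgebra H} (x : M.Elem) : H →L[ℂ] H :=
  (show M.toStarSubalgebra from x).1

/-- The weak⋆ (ultraweak) topology of `M`: the coarsest topology for which all the functionals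
`x ↦ ∑ₙ ⟨ηₙ, x ξₙ⟩` with `∑ₙ ‖ξₙ‖² < ∞` and `∑ₙ ‖ηₙ‖² < ∞` are continuous. -/
@[reducible]
def weakStar : TopologicalSpace M.Elem :=
  ⨅ p : lp (fun _ : ℕ => H) 2 × lp (fun _ : ℕ => H) 2,
    TopologicalSpace.induced (fun x : M.Elem => ∑' n, ⟪p.2 n, x.toOp (p.1 n)⟫_ℂ) inferInstance

end VonNeumannAlgebra

namespace FaithfulTracialState

variable {H : Type*} [NormedAddCommGroup H] [InnerProductSpace ℂ H] [CompleteSpace H]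
  {M : VonNeumannAlgebra H} (τ : FaithfulTracialState M.Elem)

/-- Normality of the state `τ`: weak⋆ continuity. -/
def IsNormal : Prop := Continuous[M.weakStar, (inferInstance : TopologicalSpace ℂ)] τ.tr

/-- `Φ` is a faithful normal conditional expectation from `M` onto `𝒟` with `τ ∘ Φ = τ`. -/
structure IsCondExp (D : Subalgebra ℂ M.Elem) (Φ : M.Elem →ₗ[ℂ] M.Elem) : Prop where
  map_mem : ∀ x, Φ x ∈ D
  map_of_mem : ∀ d ∈ D, Φ d = d
  map_nonneg : ∀ x, 0 ≤ x → 0 ≤ Φ x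
  map_mul_mul : ∀ x, ∀ d ∈ D, ∀ e ∈ D, Φ (d * x * e) = d * Φ x * e
  faithful : ∀ x, Φ (star x * x) = 0 → x = 0
  normal : Continuous[M.weakStar, M.weakStar] Φ
  tr_map : ∀ x, τ.tr (Φ x) = τ.tr x

open scoped Classical in
/-- The trace preserving faithful normal conditional expectation from `M` onto `𝒟` (there is at
most one; the value is `0` if there is none). -/
def condExp (D : Subalgebra ℂ M.Elem) : M.Elem →ₗ[ℂ] M.Elem :=
  if h : ∃ Φ, τ.IsCondExp D Φ then h.choose else 0

/-- The diagonal `𝒟 = A ∩ A⋆`. -/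
def diag (A : Subalgebra ℂ M.Elem) : Subalgebra ℂ M.Elem := A ⊓ star A

/-- `A₀ = A ∩ Ker Φ`. -/
def zeroPart (A : Subalgebra ℂ M.Elem) : Submodule ℂ M.Elem :=
  A.toSubmodule ⊓ LinearMap.ker (τ.condExp (diag A))

/-- Tracial subalgebras of `M`: weak⋆ closed unital subalgebras `A` on which the trace preserving
faithful normal conditional expectation from `M` onto `A ∩ A⋆` is multiplicative. -/
structure IsTracialSubalgebra (A : Subalgebra ℂ M.Elem) : Prop where
  isClosed : IsClosed[M.weakStar] (A : Set M.Elem)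
  exists_condExp_map_mul : ∃ Φ : M.Elem →ₗ[ℂ] M.Elem, τ.IsCondExp (diag A) Φ ∧
    ∀ a ∈ A, ∀ b ∈ A, Φ (a * b) = Φ a * Φ b

/-- Maximal subdiagonal algebras: tracial subalgebras `A` with `A + A⋆` weak⋆ dense in `M`. -/
structure IsMaximalSubdiagonal (A : Subalgebra ℂ M.Elem) : Prop extends
    τ.IsTracialSubalgebra A where
  dense : @Dense _ M.weakStar {x : M.Elem | ∃ a ∈ A, ∃ b ∈ A, x = a + star b}

/-- (Right) `A`-invariant subspaces of `L²(M)`: closed subspaces `K` with `K A ⊆ K`. -/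
structure IsInvariant (A : Subalgebra ℂ M.Elem) (K : Submodule ℂ τ.L2) : Prop where
  isClosed : IsClosed (K : Set τ.L2)
  rightMul_mem : ∀ x ∈ K, ∀ a ∈ A, τ.rightMul a x ∈ K

/-- Simply invariant subspaces: invariant subspaces `K` with `[K A₀]₂` properly contained
in `K`. -/
structure IsSimplyInvariant (A : Subalgebra ℂ M.Elem) (K : Submodule ℂ τ.L2) : Prop extends
    τ.IsInvariant A K where
  lt : τ.closedMul K (τ.zeroPart A) < K

/-- The right wandering subspace `K ⊖ [K A₀]₂`. -/
def wandering (A : Subalgebra ℂ M.Elem) (K : Submodule ℂ τ.L2) : Submodule ℂ τ.L2 :=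
  K ⊓ (τ.closedMul K (τ.zeroPart A))ᗮ

/-- Type 2 invariant subspaces: the right wandering subspace is zero. -/
structure IsTypeTwo (A : Subalgebra ℂ M.Elem) (K : Submodule ℂ τ.L2) : Prop extends
    τ.IsInvariant A K where
  wandering_eq_bot : τ.wandering A K = ⊥

/-- `X = Z ⊕ᶜᵒˡ [Y A]₂` with `Z`, `Y` closed subspaces of `X`, `Z` a type 2 invariant subspace and
`Y⋆ Y ⊆ L¹(𝒟)`. -/
structure IsDecomposition (A : Subalgebra ℂ M.Elem) (X Z Y : Submodule ℂ τ.L2) : Prop where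
  left_le : Z ≤ X
  right_le : Y ≤ X
  isClosed_right : IsClosed (Y : Set τ.L2)
  isTypeTwo : τ.IsTypeTwo A Z
  starMul_mem : ∀ y ∈ Y, ∀ x ∈ Y, τ.starMul y x ∈ τ.L1Of (diag A)
  isColumnSum : τ.IsColumnSum X ![Z, τ.closedMul Y A]

/-- `Y` is a right `𝒟`-submodule of `L²(M)`. -/
def IsDiagSubmodule (A : Subalgebra ℂ M.Elem) (Y : Submodule ℂ τ.L2) : Prop :=
  ∀ y ∈ Y, ∀ d ∈ diag A, τ.rightMul d y ∈ Y

end FaithfulTracialState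

end

/-
By duality with `M`, an element `f` of `L¹(M)` lies in `L¹(𝒟)` iff `τ(f b) = τ(f Φ(b))` for all
`b ∈ M`, and `ξ⋆ η` is determined by the coefficients `τ(ξ⋆ η b) = ⟪ξ, η b⟫`. If `(Z, Y)` is a
decomposition of `X`, then `X = [X A₀]₂ ⊕ [Y 𝒟]₂`: indeed `Z = [Z A₀]₂`, `A = A₀ + 𝒟`, and
`⟪y d, x a⟫ = τ(y⋆ x Φ(a) d⋆) = 0` for `a ∈ A₀`. Hence `[Y 𝒟]₂` is the wandering subspace of `X`,
and `Z` is the orthogonal complement of `[Y A]₂` in `X`.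

For existence, put `Y = X ⊖ [X A₀]₂` and `Z = X ⊖ [Y A]₂`. The orthogonality relations give
`⟪ξ, η a⟫ = ⟪ξ, η Φ(a)⟫` for `η ∈ Y`, `ξ ∈ Y + Z` and `a ∈ A ∪ A⋆`. By density this extends to all
`a ∈ M`, provided that the coefficients `a ↦ ⟪ξ, η a⟫` are weak⋆ continuous. To see this, dominate
the normal trace `τ` by a vector functional `b ↦ ⟪ζ, ρ(b) ζ⟫` of an amplification `ρ` of `M`. Then
`V : ρ(b) ζ ↦ b` is a contraction which intertwines `ρ` with the GNS representation, so `√(V⋆ V)`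
commutes with `ρ` and `θ = √(V⋆ V) ζ` satisfies `τ(b) = ⟪θ, ρ(b) θ⟫`. As `τ` is a trace,
`x ↦ ρ(x⋆) θ` extends to a conjugate-linear isometry of `L²(M)` which turns the coefficients of the
right action into coefficients of `ρ`.
-/

noncomputable section

/-! ### Duality between `L¹(M)` and `M` -/

namespace FaithfulTracialState

section Pairing

variable {M : Type*} [CStarAlgebra M] [PartialOrder M] [StarOrderedRing M]
  (τ : FaithfulTracialState M)

theorem denseRange_toL2 : DenseRange τ.toL2 := τ.denseRange_coeL2

theorem denseRange_toL1 : DenseRange τ.toL1 :=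
  UniformSpace.Completion.denseRange_coe (α := τ.PreL1)

theorem inner_toL2 (x y : M) : ⟪τ.toL2 x, τ.toL2 y⟫_ℂ = τ.tr (star x * y) :=
  UniformSpace.Completion.inner_coe (τ.tr.toPreGNS x) (τ.tr.toPreGNS y)

theorem norm_toL2_sq (x : M) : ‖τ.toL2 x‖ ^ 2 = ‖τ.tr (star x * x)‖ := by
  rw [← inner_toL2, inner_self_eq_norm_sq_to_K]
  simp

theorem rightMul_rightMul (a b : M) (ξ : τ.L2) :
    τ.rightMul b (τ.rightMul a ξ) = τ.rightMul (a * b) ξ := by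
  refine τ.denseRange_toL2.induction_on ξ (isClosed_eq (by fun_prop) (by fun_prop)) fun x => ?_
  simp only [rightMul_toL2, mul_assoc]

theorem rightMul_one (ξ : τ.L2) : τ.rightMul 1 ξ = ξ := by
  refine τ.denseRange_toL2.induction_on ξ (isClosed_eq (by fun_prop) (by fun_prop)) fun x => ?_
  rw [rightMul_toL2, mul_one]

theorem rightMul_add (a b : M) (ξ : τ.L2) :
    τ.rightMul (a + b) ξ = τ.rightMul a ξ + τ.rightMul b ξ := by
  refine τ.denseRange_toL2.induction_on ξ (isClosed_eq (by fun_prop) (by fun_prop)) fun x => ?_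
  simp only [rightMul_toL2, mul_add, map_add]

theorem rightMul_zero (ξ : τ.L2) : τ.rightMul 0 ξ = 0 := by
  simpa using τ.rightMul_add 0 0 ξ

theorem inner_rightMul_left (a : M) (ξ η : τ.L2) :
    ⟪τ.rightMul a ξ, η⟫_ℂ = ⟪ξ, τ.rightMul (star a) η⟫_ℂ := by
  refine τ.denseRange_toL2.induction_on₂
    (p := fun ξ η => ⟪τ.rightMul a ξ, η⟫_ℂ = ⟪ξ, τ.rightMul (star a) η⟫_ℂ)
    (isClosed_eq (by fun_prop) (by fun_prop)) (fun x y => ?_) ξ η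
  rw [rightMul_toL2, rightMul_toL2, inner_toL2, inner_toL2, star_mul, mul_assoc, tr_mul_comm,
    mul_assoc]

theorem conj_inner_rightMul (a : M) (ξ η : τ.L2) :
    starRingEnd ℂ ⟪ξ, τ.rightMul a η⟫_ℂ = ⟪η, τ.rightMul (star a) ξ⟫_ℂ := by
  rw [inner_conj_symm, inner_rightMul_left]

/-- The functional `f ↦ τ(f b)` on `L¹(M)`, which identifies `b ∈ M` with an element of the dual
of `L¹(M)`. -/
def pairing (b : M) : τ.L1 →L[ℂ] ℂ :=
  (τ.tr.toLinearMap ∘ₗ LinearMap.mulRight ℂ b).extendOfNorm τ.toL1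

theorem norm_tr_mul_le_norm_toL1 (b x : M) : ‖τ.tr (x * b)‖ ≤ ‖b‖ * ‖τ.toL1 x‖ :=
  (τ.norm_tr_mul_le_norm1 x b).trans_eq (by rw [norm_toL1])

theorem pairing_toL1 (b x : M) : τ.pairing b (τ.toL1 x) = τ.tr (x * b) :=
  LinearMap.extendOfNorm_eq τ.denseRange_toL1 ⟨‖b‖, τ.norm_tr_mul_le_norm_toL1 b⟩ x

theorem norm_pairing_le (b : M) (f : τ.L1) : ‖τ.pairing b f‖ ≤ ‖b‖ * ‖f‖ :=
  LinearMap.norm_extendOfNorm_apply_le τ.denseRange_toL1 ‖b‖ (τ.norm_tr_mul_le_norm_toL1 b) f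

theorem norm_le_of_norm_pairing_le {f : τ.L1} {C : ℝ}
    (h : ∀ b, ‖b‖ ≤ 1 → ‖τ.pairing b f‖ ≤ C) : ‖f‖ ≤ C := by
  refine le_of_forall_pos_le_add fun ε hε => ?_
  obtain ⟨x, hx⟩ := τ.denseRange_toL1.exists_dist_lt f (by positivity : 0 < ε / 3)
  obtain ⟨b, hb, hxb⟩ := τ.exists_norm1_le x (by positivity : 0 < ε / 3)
  rw [dist_eq_norm] at hx
  rw [← norm_toL1, ← pairing_toL1] at hxb
  have hdiff : ‖τ.pairing b (f - τ.toL1 x)‖ ≤ ε / 3 :=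
    (τ.norm_pairing_le b _).trans ((mul_le_of_le_one_left (norm_nonneg _) hb).trans hx.le)
  have hpair : ‖τ.pairing b (τ.toL1 x)‖ ≤ ‖τ.pairing b f‖ + ‖τ.pairing b (f - τ.toL1 x)‖ := by
    simpa only [map_sub, sub_sub_cancel] using
      norm_sub_le (τ.pairing b f) (τ.pairing b (f - τ.toL1 x))
  have hnorm : ‖f‖ ≤ ‖f - τ.toL1 x‖ + ‖τ.toL1 x‖ := norm_le_norm_sub_add f _
  linarith [h b hb]

theorem eq_zero_of_pairing_eq_zero {f : τ.L1} (h : ∀ b, τ.pairing b f = 0) : f = 0 :=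
  norm_le_zero_iff.1 <| τ.norm_le_of_norm_pairing_le fun b _ => by rw [h, norm_zero]

theorem ext_pairing {f g : τ.L1} (h : ∀ b, τ.pairing b f = τ.pairing b g) : f = g :=
  sub_eq_zero.1 <| τ.eq_zero_of_pairing_eq_zero fun b => by rw [map_sub, h, sub_self]

theorem pairing_starMul (b : M) (ξ η : τ.L2) :
    τ.pairing b (τ.starMul ξ η) = ⟪ξ, τ.rightMul b η⟫_ℂ := by
  refine τ.denseRange_toL2.induction_on₂
    (p := fun ξ η => τ.pairing b (τ.starMul ξ η) = ⟪ξ, τ.rightMul b η⟫_ℂ)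
    (isClosed_eq (by fun_prop) (by fun_prop)) (fun x y => ?_) ξ η
  rw [starMul_toL2, pairing_toL1, rightMul_toL2, inner_toL2, mul_assoc]

theorem starMul_eq_zero_iff {ξ η : τ.L2} :
    τ.starMul ξ η = 0 ↔ ∀ b, ⟪ξ, τ.rightMul b η⟫_ℂ = 0 := by
  refine ⟨fun h b => ?_, fun h => τ.eq_zero_of_pairing_eq_zero fun b => ?_⟩
  · rw [← pairing_starMul, h, map_zero]
  · rw [pairing_starMul, h]

theorem inner_eq_zero_of_starMul_eq_zero {ξ η : τ.L2} (h : τ.starMul ξ η = 0) :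
    ⟪ξ, η⟫_ℂ = 0 := by
  simpa only [rightMul_one] using τ.starMul_eq_zero_iff.1 h 1

theorem starMul_eq_zero_symm {ξ η : τ.L2} (h : τ.starMul ξ η = 0) : τ.starMul η ξ = 0 :=
  τ.starMul_eq_zero_iff.2 fun b => by
    rw [← star_star b, ← conj_inner_rightMul, τ.starMul_eq_zero_iff.1 h, map_zero]

end Pairing

/-! ### Conditional expectations and `L¹(𝒟)` -/

section CondExp

variable {H : Type*} [NormedAddCommGroup H] [InnerProductSpace ℂ H] [CompleteSpace H]
  {M : VonNeumannAlgebra H} {τ : FaithfulTracialState M.Elem}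
  {D A : Subalgebra ℂ M.Elem} {Φ Ψ : M.Elem →ₗ[ℂ] M.Elem}

variable (τ Φ) in
/-- The extension to `L¹(M)` of a linear map `Φ` of `M` which is bounded for the norm `‖·‖₁` (the
value is `0` if `Φ` is not bounded). -/
def extendL1 : τ.L1 →L[ℂ] τ.L1 := (τ.toL1 ∘ₗ Φ).extendOfNorm τ.toL1

namespace IsCondExp

theorem map_mul_left (h : τ.IsCondExp D Φ) {d : M.Elem} (hd : d ∈ D) (x : M.Elem) :
    Φ (d * x) = d * Φ x := by
  simpa only [mul_one] using h.map_mul_mul x d hd 1 D.one_mem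

theorem map_mul_right (h : τ.IsCondExp D Φ) {d : M.Elem} (hd : d ∈ D) (x : M.Elem) :
    Φ (x * d) = Φ x * d := by
  simpa only [one_mul] using h.map_mul_mul x 1 D.one_mem d hd

theorem map_map (h : τ.IsCondExp D Φ) (x : M.Elem) : Φ (Φ x) = Φ x :=
  h.map_of_mem _ (h.map_mem x)

/-- A conditional expectation as a positive linear map. -/
def toPositive (h : τ.IsCondExp D Φ) : M.Elem →ₚ[ℂ] M.Elem := .mk₀ Φ h.map_nonneg

theorem map_star (h : τ.IsCondExp D Φ) (x : M.Elem) : Φ (star x) = star (Φ x) :=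
  StarHomClass.map_star h.toPositive x

theorem star_mem (h : τ.IsCondExp D Φ) {d : M.Elem} (hd : d ∈ D) : star d ∈ D := by
  rw [← h.map_of_mem d hd, ← h.map_star]
  exact h.map_mem _

theorem tr_mul_map (h : τ.IsCondExp D Φ) (x y : M.Elem) :
    τ.tr (x * Φ y) = τ.tr (Φ x * y) := by
  rw [← h.tr_map (x * Φ y), ← h.tr_map (Φ x * y), h.map_mul_right (h.map_mem y),
    h.map_mul_left (h.map_mem x)]

theorem unique (h : τ.IsCondExp D Φ) (h' : τ.IsCondExp D Ψ) : Φ = Ψ := by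
  ext x
  have hd : star (Φ x - Ψ x) ∈ D := h.star_mem (D.sub_mem (h.map_mem x) (h'.map_mem x))
  refine sub_eq_zero.1 (τ.faithful' _ ?_)
  change τ.tr (star (Φ x - Ψ x) * (Φ x - Ψ x)) = 0
  rw [mul_sub, map_sub, ← h.map_mul_left hd, ← h'.map_mul_left hd, h.tr_map, h'.tr_map, sub_self]

theorem exists_norm_toL1_map_le (h : τ.IsCondExp D Φ) :
    ∃ C, ∀ x, ‖τ.toL1 (Φ x)‖ ≤ C * ‖τ.toL1 x‖ := by
  obtain ⟨C, hC⟩ := h.toPositive.exists_norm_apply_le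
  refine ⟨C, fun x => τ.norm_le_of_norm_pairing_le fun b hb => ?_⟩
  calc ‖τ.pairing b (τ.toL1 (Φ x))‖ = ‖τ.pairing (Φ b) (τ.toL1 x)‖ := by
        rw [pairing_toL1, pairing_toL1, h.tr_mul_map]
    _ ≤ ‖Φ b‖ * ‖τ.toL1 x‖ := τ.norm_pairing_le _ _
    _ ≤ C * ‖τ.toL1 x‖ := by
        gcongr
        exact (hC b).trans (mul_le_of_le_one_right C.2 hb)

theorem extendL1_toL1 (h : τ.IsCondExp D Φ) (x : M.Elem) :
    τ.extendL1 Φ (τ.toL1 x) = τ.toL1 (Φ x) :=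
  LinearMap.extendOfNorm_eq τ.denseRange_toL1 h.exists_norm_toL1_map_le x

theorem extendL1_mem_L1Of (h : τ.IsCondExp D Φ) (f : τ.L1) : τ.extendL1 Φ f ∈ τ.L1Of D := by
  refine τ.denseRange_toL1.induction_on f
    ((Submodule.isClosed_topologicalClosure _).preimage (τ.extendL1 Φ).continuous) fun x => ?_
  rw [h.extendL1_toL1]
  exact Submodule.le_topologicalClosure _ ⟨Φ x, h.map_mem x, rfl⟩

theorem pairing_extendL1 (h : τ.IsCondExp D Φ) (b : M.Elem) (f : τ.L1) :
    τ.pairing b (τ.extendL1 Φ f) = τ.pairing (Φ b) f := by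
  refine τ.denseRange_toL1.induction_on f (isClosed_eq (by fun_prop) (by fun_prop)) fun x => ?_
  rw [h.extendL1_toL1, pairing_toL1, pairing_toL1, h.tr_mul_map]

theorem mem_L1Of_iff (h : τ.IsCondExp D Φ) {f : τ.L1} :
    f ∈ τ.L1Of D ↔ ∀ b, τ.pairing b f = τ.pairing (Φ b) f := by
  refine ⟨fun hf b => ?_, fun hf => ?_⟩
  · refine closure_minimal (t := {f : τ.L1 | τ.pairing b f = τ.pairing (Φ b) f}) ?_
      (isClosed_eq (by fun_prop) (by fun_prop)) hf
    rintro _ ⟨d, hd, rfl⟩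
    change τ.pairing b (τ.toL1 d) = τ.pairing (Φ b) (τ.toL1 d)
    rw [pairing_toL1, pairing_toL1, ← h.tr_map, h.map_mul_left hd]
  · rw [τ.ext_pairing fun b => (hf b).trans (h.pairing_extendL1 b f).symm]
    exact h.extendL1_mem_L1Of f

theorem starMul_mem_L1Of_iff (h : τ.IsCondExp D Φ) {ξ η : τ.L2} :
    τ.starMul ξ η ∈ τ.L1Of D ↔ ∀ b, ⟪ξ, τ.rightMul b η⟫_ℂ = ⟪ξ, τ.rightMul (Φ b) η⟫_ℂ := by
  simp only [h.mem_L1Of_iff, pairing_starMul]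

theorem starMul_mem_L1Of_symm (h : τ.IsCondExp D Φ) {ξ η : τ.L2}
    (hξη : τ.starMul ξ η ∈ τ.L1Of D) : τ.starMul η ξ ∈ τ.L1Of D :=
  h.starMul_mem_L1Of_iff.2 fun b => by
    rw [← star_star b, ← conj_inner_rightMul, h.starMul_mem_L1Of_iff.1 hξη, conj_inner_rightMul,
      h.map_star (star b)]

end IsCondExp

variable (τ A) in
/-- The trace preserving faithful normal conditional expectation onto `𝒟 = A ∩ A⋆` exists and is
multiplicative on `A`: tracial subalgebras without the requirement that `A` be weak⋆ closed. -/
def HasMultiplicativeCondExp : Prop :=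
  ∃ Φ : M.Elem →ₗ[ℂ] M.Elem, τ.IsCondExp (diag A) Φ ∧
    ∀ a ∈ A, ∀ b ∈ A, Φ (a * b) = Φ a * Φ b

theorem diag_le : diag A ≤ A := inf_le_left

namespace HasMultiplicativeCondExp

theorem isCondExp (hA : τ.HasMultiplicativeCondExp A) :
    τ.IsCondExp (diag A) (τ.condExp (diag A)) := by
  have h : ∃ Φ, τ.IsCondExp (diag A) Φ := hA.imp fun _ => And.left
  rw [condExp, dif_pos h]
  exact h.choose_spec

theorem condExp_mul (hA : τ.HasMultiplicativeCondExp A) {a b : M.Elem} (ha : a ∈ A) (hb : b ∈ A) :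
    τ.condExp (diag A) (a * b) = τ.condExp (diag A) a * τ.condExp (diag A) b := by
  obtain ⟨Φ, hΦ, hmul⟩ := id hA
  rw [← hΦ.unique hA.isCondExp]
  exact hmul a ha b hb

theorem mul_mem_zeroPart (hA : τ.HasMultiplicativeCondExp A) {a b : M.Elem} (ha : a ∈ A)
    (hb : b ∈ τ.zeroPart A) : a * b ∈ τ.zeroPart A := by
  refine ⟨A.mul_mem ha hb.1, LinearMap.mem_ker.2 ?_⟩
  rw [hA.condExp_mul ha hb.1, LinearMap.mem_ker.1 hb.2, mul_zero]

theorem sub_condExp_mem_zeroPart (hA : τ.HasMultiplicativeCondExp A) {a : M.Elem} (ha : a ∈ A) :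
    a - τ.condExp (diag A) a ∈ τ.zeroPart A := by
  refine ⟨A.sub_mem ha (diag_le (hA.isCondExp.map_mem a)), LinearMap.mem_ker.2 ?_⟩
  rw [map_sub, hA.isCondExp.map_map, sub_self]

end HasMultiplicativeCondExp

end CondExp

end FaithfulTracialState

/-! ### Normal functionals and amplifications -/

section Amplification

variable {G : Type*} [NormedAddCommGroup G] [InnerProductSpace ℂ G] [CompleteSpace G] {J : Type*}

/-- The amplification of operators on `G` to the Hilbert sum of copies of `G`: the operator `T`
acts by `(ξ_j) ↦ (T ξ_j)`. -/
def amplification : (G →L[ℂ] G) →⋆ₐ[ℂ] (lp (fun _ : J => G) 2 →L[ℂ] lp (fun _ : J => G) 2) where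
  toFun T := lp.mapCLM 2 (fun _ => T) (norm_nonneg T) fun _ => le_rfl
  map_one' := by ext; simp
  map_mul' S T := by ext; simp
  map_zero' := by ext; simp
  map_add' S T := by ext; simp
  commutes' c := by ext; simp [Algebra.algebraMap_eq_smul_one]
  map_star' T := by
    refine (ContinuousLinearMap.eq_adjoint_iff _ _).2 fun f g => ?_
    simp only [lp.inner_eq_tsum, lp.mapCLM_apply_coe, ContinuousLinearMap.star_eq_adjoint,
      ContinuousLinearMap.adjoint_inner_left]

theorem norm_lp_two_sq_eq_sum {G : Type*} [NormedAddCommGroup G] [Fintype J]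
    (f : lp (fun _ : J => G) 2) : ‖f‖ ^ 2 = ∑ j, ‖f j‖ ^ 2 := by
  simpa [tsum_fintype] using lp.norm_rpow_eq_tsum (by simp) f

end Amplification

section OrbitMap

variable {M : Type*} [CStarAlgebra M]
  {E : Type*} [NormedAddCommGroup E] [InnerProductSpace ℂ E] [CompleteSpace E]
  (ρ : M →⋆ₐ[ℂ] (E →L[ℂ] E))

theorem inner_starAlgHom_left (b : M) (u v : E) : ⟪ρ b u, v⟫_ℂ = ⟪u, ρ (star b) v⟫_ℂ := by
  rw [map_star, ContinuousLinearMap.star_eq_adjoint, ContinuousLinearMap.adjoint_inner_right]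

/-- The orbit map `b ↦ ρ(b) ζ` of a vector `ζ` under a representation `ρ`. -/
def orbitMap (ζ : E) : M →ₗ[ℂ] E :=
  (ContinuousLinearMap.apply ℂ E ζ).toLinearMap ∘ₗ ρ.toAlgHom.toLinearMap

@[simp]
theorem orbitMap_apply (ζ : E) (b : M) : orbitMap ρ ζ b = ρ b ζ := rfl

theorem map_mem_orthogonal_range_orbitMap {ζ : E} (b : M) {v : E}
    (hv : v ∈ (LinearMap.range (orbitMap ρ ζ))ᗮ) : ρ b v ∈ (LinearMap.range (orbitMap ρ ζ))ᗮ := by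
  rintro _ ⟨c, rfl⟩
  have h : ⟪orbitMap ρ ζ (star b * c), v⟫_ℂ = 0 := hv _ ⟨_, rfl⟩
  rwa [orbitMap_apply, map_mul, mul_apply_eq_comp, inner_starAlgHom_left, star_star] at h

end OrbitMap

section NormalFunctional

variable {H : Type*} [NormedAddCommGroup H] [InnerProductSpace ℂ H] [CompleteSpace H]
  (M : VonNeumannAlgebra H)

/-- The amplification of the identity representation of `M` to `H ⊗ ℓ²(ℕ)`. -/
def countableAmplification :
    M.Elem →⋆ₐ[ℂ] (lp (fun _ : ℕ => H) 2 →L[ℂ] lp (fun _ : ℕ => H) 2) :=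
  amplification.comp (show M.Elem →⋆ₐ[ℂ] (H →L[ℂ] H) from M.toStarSubalgebra.subtype)

/-- The functional `x ↦ ∑ₙ ⟨ηₙ, x ξₙ⟩` attached to the pair `p = (ξ, η)` of sequences, as in the
definition of the weak⋆ topology. -/
def normalFunctional (p : lp (fun _ : ℕ => H) 2 × lp (fun _ : ℕ => H) 2) : M.Elem →ₗ[ℂ] ℂ :=
  (innerSL ℂ p.2).toLinearMap ∘ₗ orbitMap (countableAmplification M) p.1

variable {M}

theorem normalFunctional_apply (p : lp (fun _ : ℕ => H) 2 × lp (fun _ : ℕ => H) 2) (x : M.Elem) :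
    normalFunctional M p x = ⟪p.2, countableAmplification M x p.1⟫_ℂ := rfl

variable (M) in
theorem weakStar_eq_iInf_induced_normalFunctional :
    M.weakStar = ⨅ p, TopologicalSpace.induced (normalFunctional M p) inferInstance :=
  iInf_congr fun _ => by congr 1

theorem continuous_normalFunctional (p : lp (fun _ : ℕ => H) 2 × lp (fun _ : ℕ => H) 2) :
    Continuous[M.weakStar, inferInstance] (normalFunctional M p) := by
  rw [weakStar_eq_iInf_induced_normalFunctional]
  exact continuous_iInf_dom continuous_induced_dom

theorem continuous_sum_normalFunctional {J : Type*} [Fintype J]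
    (p : J → lp (fun _ : ℕ => H) 2 × lp (fun _ : ℕ => H) 2) :
    Continuous[M.weakStar, inferInstance] fun x => ∑ j, normalFunctional M (p j) x := by
  let _ := M.weakStar
  exact continuous_finsetSum _ fun j _ => continuous_normalFunctional (p j)

theorem exists_eq_sum_normalFunctional {φ : M.Elem →ₗ[ℂ] ℂ}
    (hφ : Continuous[M.weakStar, inferInstance] φ) :
    ∃ (s : Finset (lp (fun _ : ℕ => H) 2 × lp (fun _ : ℕ => H) 2))
      (p : s → lp (fun _ : ℕ => H) 2 × lp (fun _ : ℕ => H) 2),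
      ∀ b, φ b = ∑ j, normalFunctional M (p j) b := by
  rw [weakStar_eq_iInf_induced_normalFunctional] at hφ
  obtain ⟨c, hc⟩ := Finsupp.mem_span_range_iff_exists_finsupp.1
    ((LinearMap.mem_span_iff_continuous φ).2 hφ)
  refine ⟨c.support, fun j => (c j • j.1.1, j.1.2), fun b => ?_⟩
  calc φ b = ∑ p ∈ c.support, c p * normalFunctional M p b := by
        simp [← hc, Finsupp.sum]
    _ = ∑ j : c.support, normalFunctional M (c j • j.1.1, j.1.2) b := by
        rw [← Finset.sum_coe_sort]
        simp only [normalFunctional_apply, map_smul, inner_smul_right]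

theorem norm_normalFunctional_star_mul_self_le
    (p : lp (fun _ : ℕ => H) 2 × lp (fun _ : ℕ => H) 2) (b : M.Elem) :
    ‖normalFunctional M p (star b * b)‖ ≤
      ‖countableAmplification M b p.1‖ ^ 2 + ‖countableAmplification M b p.2‖ ^ 2 := by
  rw [normalFunctional_apply, map_mul, mul_apply_eq_comp, ← inner_starAlgHom_left]
  refine (norm_inner_le_norm _ _).trans ?_
  nlinarith [sq_nonneg (‖countableAmplification M b p.1‖ - ‖countableAmplification M b p.2‖),
    sq_nonneg ‖countableAmplification M b p.1‖, sq_nonneg ‖countableAmplification M b p.2‖]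

theorem exists_norm_sum_normalFunctional_star_mul_self_le {J : Type*} [Fintype J]
    (p : J → lp (fun _ : ℕ => H) 2 × lp (fun _ : ℕ => H) 2) :
    ∃ ζ : lp (fun _ : J ⊕ J => lp (fun _ : ℕ => H) 2) 2, ∀ b,
      ‖∑ j, normalFunctional M (p j) (star b * b)‖ ≤
        ‖amplification.comp (countableAmplification M) b ζ‖ ^ 2 := by
  refine ⟨⟨Sum.elim (fun j => (p j).1) (fun j => (p j).2), Memℓp.all _⟩, fun b => ?_⟩
  rw [norm_lp_two_sq_eq_sum, Fintype.sum_sum_type, ← Finset.sum_add_distrib]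
  exact norm_sum_le_of_le _ fun j _ => norm_normalFunctional_star_mul_self_le (p j) b

end NormalFunctional

/-! ### Traces dominated by a vector functional -/

section Hilbert

variable {𝕜 E F : Type*} [RCLike 𝕜] [NormedAddCommGroup E] [InnerProductSpace 𝕜 E]
  [CompleteSpace E]

theorem dense_sup_orthogonal (K : Submodule 𝕜 E) : Dense ((K ⊔ Kᗮ : Submodule 𝕜 E) : Set E) := by
  rw [Submodule.dense_iff_topologicalClosure_eq_top, Submodule.topologicalClosure_eq_top_iff,
    ← Submodule.inf_orthogonal, Submodule.inf_orthogonal_eq_bot]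

theorem clm_ext_of_orthogonal [NormedAddCommGroup F] [NormedSpace 𝕜 F] {K : Submodule 𝕜 E}
    {S T : E →L[𝕜] F} (hK : ∀ x ∈ K, S x = T x) (hKo : ∀ x ∈ Kᗮ, S x = T x) : S = T := by
  refine DFunLike.coe_injective
    (Continuous.ext_on (dense_sup_orthogonal K) S.continuous T.continuous fun x hx => ?_)
  obtain ⟨y, hy, z, hz, rfl⟩ := Submodule.mem_sup.1 hx
  rw [map_add, map_add, hK y hy, hKo z hz]

theorem exists_clm_of_norm_le {V : Type*} [AddCommGroup V] [Module 𝕜 V]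
    [NormedAddCommGroup F] [NormedSpace 𝕜 F] [CompleteSpace F] (f : V →ₗ[𝕜] E) (g : V →ₗ[𝕜] F)
    (h : ∀ x, ‖g x‖ ≤ ‖f x‖) :
    ∃ T : E →L[𝕜] F, (∀ x, T (f x) = g x) ∧ ∀ w ∈ (LinearMap.range f)ᗮ, T w = 0 := by
  let K := LinearMap.range f
  let e : V × Kᗮ →ₗ[𝕜] E := f.coprod Kᗮ.subtype
  have he : DenseRange e := by
    have hrange : LinearMap.range e = K ⊔ Kᗮ := by
      rw [LinearMap.range_coprod, Submodule.range_subtype]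
    have hdense := dense_sup_orthogonal K
    rwa [← hrange] at hdense
  have hle : ∀ x, ‖(g ∘ₗ LinearMap.fst 𝕜 V Kᗮ) x‖ ≤ 1 * ‖e x‖ := fun ⟨x, w⟩ => by
    have hpyth : ‖f x + w‖ * ‖f x + w‖ = ‖f x‖ * ‖f x‖ + ‖(w : E)‖ * ‖(w : E)‖ :=
      norm_add_sq_eq_norm_sq_add_norm_sq_of_inner_eq_zero (𝕜 := 𝕜) _ _ (w.2 _ ⟨x, rfl⟩)
    rw [one_mul]
    refine (h x).trans (le_of_sq_le_sq ?_ (norm_nonneg _))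
    change _ ≤ ‖f x + w‖ ^ 2
    nlinarith [mul_self_nonneg ‖(w : E)‖]
  have hT := LinearMap.extendOfNorm_eq he ⟨1, hle⟩
  refine ⟨(g ∘ₗ LinearMap.fst 𝕜 V Kᗮ).extendOfNorm e, fun x => ?_, fun w hw => ?_⟩
  · simpa [e] using hT (x, 0)
  · simpa [e] using hT (0, ⟨w, hw⟩)

theorem inner_sqrt_apply_sqrt_apply {E : Type*} [NormedAddCommGroup E] [InnerProductSpace ℂ E]
    [CompleteSpace E] {P : E →L[ℂ] E} (hP : 0 ≤ P) (u v : E) :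
    ⟪CFC.sqrt P u, CFC.sqrt P v⟫_ℂ = ⟪u, P v⟫_ℂ := by
  rw [← ContinuousLinearMap.adjoint_inner_right,
    (CFC.sqrt_nonneg P).isSelfAdjoint.adjoint_eq, ← mul_apply_eq_comp,
    CFC.sqrt_mul_sqrt_self P]

end Hilbert

section Intertwiner

variable {M : Type*} [CStarAlgebra M]
  {E : Type*} [NormedAddCommGroup E] [InnerProductSpace ℂ E] [CompleteSpace E]
  {ρ : M →⋆ₐ[ℂ] (E →L[ℂ] E)} {ζ : E}

theorem commute_adjoint_comp_self {F : Type*} [NormedAddCommGroup F] [InnerProductSpace ℂ F]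
    [CompleteSpace F] {π : M →⋆ₐ[ℂ] (F →L[ℂ] F)} {V : E →L[ℂ] F}
    (hV : ∀ b, V ∘SL ρ b = π b ∘SL V) (b : M) :
    Commute (ContinuousLinearMap.adjoint V ∘SL V) (ρ b) := by
  have hV' : ∀ b u, V (ρ b u) = π b (V u) := fun b => DFunLike.congr_fun (hV b)
  ext v
  refine ext_inner_left ℂ fun u => ?_
  simp only [mul_apply_eq_comp, ContinuousLinearMap.comp_apply]
  rw [← star_star b, ← inner_starAlgHom_left, ContinuousLinearMap.adjoint_inner_right,
    ContinuousLinearMap.adjoint_inner_right, hV', hV', inner_starAlgHom_left]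

namespace FaithfulTracialState

variable [PartialOrder M] [StarOrderedRing M] {τ : FaithfulTracialState M}

theorem exists_intertwiner (h : ∀ b, ‖τ.toL2 b‖ ≤ ‖ρ b ζ‖) :
    ∃ V : E →L[ℂ] τ.L2, (∀ b, V (ρ b ζ) = τ.toL2 b) ∧
      ∀ b, V ∘SL ρ b = τ.tr.gnsStarAlgHom b ∘SL V := by
  obtain ⟨V, hV, hV₀⟩ := exists_clm_of_norm_le (orbitMap ρ ζ) τ.toL2 h
  simp only [orbitMap_apply] at hV
  refine ⟨V, hV, fun b => clm_ext_of_orthogonal (K := LinearMap.range (orbitMap ρ ζ)) ?_ ?_⟩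
  · rintro _ ⟨c, rfl⟩
    rw [ContinuousLinearMap.comp_apply, ContinuousLinearMap.comp_apply, orbitMap_apply,
      ← mul_apply_eq_comp, ← map_mul, hV, hV]
    exact (PositiveLinearMap.gnsNonUnitalStarAlgHom_apply_coe (f := τ.tr) (a := b)
      (b := τ.tr.toPreGNS c)).symm
  · intro w hw
    rw [ContinuousLinearMap.comp_apply, ContinuousLinearMap.comp_apply, hV₀ w hw, map_zero,
      hV₀ _ (map_mem_orthogonal_range_orbitMap ρ b hw)]

theorem exists_traceVector (h : ∀ b, ‖τ.toL2 b‖ ≤ ‖ρ b ζ‖) :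
    ∃ θ : E, ∀ x y, ⟪ρ x θ, ρ y θ⟫_ℂ = τ.tr (star x * y) := by
  obtain ⟨V, hVζ, hV⟩ := exists_intertwiner h
  have hP : 0 ≤ ContinuousLinearMap.adjoint V ∘SL V :=
    (ContinuousLinearMap.nonneg_iff_isPositive _).2
      (ContinuousLinearMap.isPositive_adjoint_comp_self V)
  set P := ContinuousLinearMap.adjoint V ∘SL V
  have hθ : ∀ b, ρ b (CFC.sqrt P ζ) = CFC.sqrt P (ρ b ζ) := fun b =>
    DFunLike.congr_fun ((commute_adjoint_comp_self hV b).cfcₙ_nnreal _).symm.eq ζ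
  refine ⟨CFC.sqrt P ζ, fun x y => ?_⟩
  rw [hθ, hθ, inner_sqrt_apply_sqrt_apply hP, ContinuousLinearMap.comp_apply,
    ContinuousLinearMap.adjoint_inner_right, hVζ, hVζ, inner_toL2]

theorem exists_conjLinear_toL2_eq {θ : E} (hθ : ∀ x y, ⟪ρ x θ, ρ y θ⟫_ℂ = τ.tr (star x * y)) :
    ∃ W : τ.L2 →L⋆[ℂ] E, ∀ x, W (τ.toL2 x) = ρ (star x) θ := by
  let f : M →ₗ⋆[ℂ] E :=
    { toFun := fun x => ρ (star x) θ
      map_add' := fun x y => by simp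
      map_smul' := fun c x => by simp }
  refine ⟨f.extendOfNorm τ.toL2,
    LinearMap.extendOfNorm_eq τ.denseRange_toL2 ⟨1, fun x => le_of_eq ?_⟩⟩
  change ‖ρ (star x) θ‖ = 1 * ‖τ.toL2 x‖
  rw [one_mul, ← sq_eq_sq₀ (norm_nonneg _) (norm_nonneg _), norm_toL2_sq, tr_mul_comm,
    ← inner_self_eq_norm_sq (𝕜 := ℂ), inner_self_re_eq_norm, hθ, star_star]

theorem exists_inner_rightMul_eq (h : ∀ b, ‖τ.toL2 b‖ ≤ ‖ρ b ζ‖) (ξ η : τ.L2) :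
    ∃ u v : E, ∀ b, ⟪ξ, τ.rightMul b η⟫_ℂ = ⟪u, ρ b v⟫_ℂ := by
  obtain ⟨θ, hθ⟩ := exists_traceVector h
  obtain ⟨W, hW⟩ := exists_conjLinear_toL2_eq hθ
  refine ⟨W η, W ξ, fun b => ?_⟩
  refine τ.denseRange_toL2.induction_on₂
    (p := fun ξ η => ⟪ξ, τ.rightMul b η⟫_ℂ = ⟪W η, ρ b (W ξ)⟫_ℂ)
    (isClosed_eq (by fun_prop) (by fun_prop)) (fun x y => ?_) ξ η
  calc ⟪τ.toL2 x, τ.rightMul b (τ.toL2 y)⟫_ℂ = τ.tr (star x * (y * b)) := by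
        rw [rightMul_toL2, inner_toL2]
    _ = τ.tr (y * (b * star x)) := by rw [tr_mul_comm, mul_assoc]
    _ = ⟪W (τ.toL2 y), ρ b (W (τ.toL2 x))⟫_ℂ := by
        rw [hW, hW, ← mul_apply_eq_comp, ← map_mul, hθ, star_star]

end FaithfulTracialState

end Intertwiner

namespace FaithfulTracialState

theorem IsNormal.continuous_inner_rightMul {H : Type*} [NormedAddCommGroup H]
    [InnerProductSpace ℂ H] [CompleteSpace H] {M : VonNeumannAlgebra H}
    {τ : FaithfulTracialState M.Elem} (hτ : τ.IsNormal) (ξ η : τ.L2) :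
    Continuous[M.weakStar, inferInstance] fun b => ⟪ξ, τ.rightMul b η⟫_ℂ := by
  obtain ⟨s, p, hp⟩ := exists_eq_sum_normalFunctional (φ := τ.tr.toLinearMap) hτ
  obtain ⟨ζ, hζ⟩ := exists_norm_sum_normalFunctional_star_mul_self_le (M := M) p
  have hdom : ∀ b, ‖τ.toL2 b‖ ≤ ‖amplification.comp (countableAmplification M) b ζ‖ := fun b =>
    le_of_sq_le_sq ((τ.norm_toL2_sq b).trans_le
      ((congrArg norm (hp (star b * b))).trans_le (hζ b))) (norm_nonneg _)
  obtain ⟨u, v, huv⟩ := exists_inner_rightMul_eq hdom ξ η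
  have hsum : ∀ b, ⟪ξ, τ.rightMul b η⟫_ℂ = ∑ j, normalFunctional M (v j, u j) b := fun b => by
    rw [huv, lp.inner_eq_tsum, tsum_fintype]
    rfl
  simpa only [hsum] using continuous_sum_normalFunctional fun j => (v j, u j)

end FaithfulTracialState

/-! ### Invariant subspaces -/

section Submodule

variable {𝕜 E : Type*} [RCLike 𝕜] [NormedAddCommGroup E] [InnerProductSpace 𝕜 E]
  {K L X : Submodule 𝕜 E}

theorem isClosed_sup_of_isOrtho [CompleteSpace E] (h : K ⟂ L) (hK : IsClosed (K : Set E))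
    (hL : IsClosed (L : Set E)) : IsClosed ((K ⊔ L : Submodule 𝕜 E) : Set E) := by
  have := hK.completeSpace_coe
  have := hL.completeSpace_coe
  suffices ((K ⊔ L : Submodule 𝕜 E) : Set E) = {x | K.starProjection x + L.starProjection x = x} by
    rw [this]
    exact isClosed_eq (by fun_prop) continuous_id
  ext x
  refine ⟨fun hx => ?_, fun hx => ?_⟩
  · obtain ⟨k, hk, l, hl, rfl⟩ := Submodule.mem_sup.1 hx
    change K.starProjection (k + l) + L.starProjection (k + l) = k + l
    rw [map_add, map_add, Submodule.starProjection_eq_self_iff.2 hk,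
      Submodule.starProjection_eq_self_iff.2 hl,
      (Submodule.starProjection_apply_eq_zero_iff _).2 (h.symm.le hl),
      (Submodule.starProjection_apply_eq_zero_iff _).2 (h.le hk), add_zero, zero_add]
  · rw [← show _ = x from hx]
    exact Submodule.add_mem_sup (K.starProjection_apply_mem x) (L.starProjection_apply_mem x)

theorem sup_inf_orthogonal_of_isClosed [CompleteSpace E] (hK : IsClosed (K : Set E))
    (hKX : K ≤ X) : K ⊔ X ⊓ Kᗮ = X := by
  have := hK.completeSpace_coe
  rw [inf_comm, Submodule.sup_orthogonal_inf_of_hasOrthogonalProjection hKX]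

theorem inf_orthogonal_eq_of_isOrtho_sup (h : K ⟂ L) (hX : X = K ⊔ L) : X ⊓ Kᗮ = L := by
  rw [hX, sup_comm, sup_inf_assoc_of_le K h.symm.le, Submodule.inf_orthogonal_eq_bot, sup_bot_eq]

end Submodule

theorem iSup_cons_pair {α : Type*} [CompleteLattice α] (a b : α) :
    ⨆ i, ![a, b] i = a ⊔ b := by
  rw [iSup, Matrix.range_cons, Matrix.range_cons, Matrix.range_empty, Set.union_empty,
    Set.singleton_union, sSup_pair]

namespace FaithfulTracialState

section ClosedMul

variable {M : Type*} [CStarAlgebra M] [PartialOrder M] [StarOrderedRing M]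
  {τ : FaithfulTracialState M} {K X Y Z W : Submodule ℂ τ.L2} {S T : Set M}

theorem rightMul_mem_closedMul {x : τ.L2} {a : M} (hx : x ∈ X) (ha : a ∈ S) :
    τ.rightMul a x ∈ τ.closedMul X S :=
  Submodule.le_topologicalClosure _ (Submodule.subset_span ⟨x, hx, a, ha, rfl⟩)

theorem isClosed_closedMul : IsClosed (τ.closedMul X S : Set τ.L2) :=
  Submodule.isClosed_topologicalClosure _

theorem closedMul_le (hK : IsClosed (K : Set τ.L2))
    (h : ∀ x ∈ X, ∀ a ∈ S, τ.rightMul a x ∈ K) : τ.closedMul X S ≤ K := by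
  refine Submodule.topologicalClosure_minimal _ (Submodule.span_le.2 ?_) hK
  rintro _ ⟨x, hx, a, ha, rfl⟩
  exact h x hx a ha

theorem closedMul_mono (hXY : X ≤ Y) (hST : S ⊆ T) : τ.closedMul X S ≤ τ.closedMul Y T :=
  closedMul_le isClosed_closedMul fun _ hx _ ha => rightMul_mem_closedMul (hXY hx) (hST ha)

theorem closedMul_bot : τ.closedMul ⊥ S = ⊥ := by
  refine le_bot_iff.1 (closedMul_le (by simp) fun x hx a _ => ?_)
  rw [(Submodule.mem_bot ℂ).1 hx, map_zero]
  exact zero_mem _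

theorem le_closedMul (hS : 1 ∈ S) : X ≤ τ.closedMul X S := fun x hx => by
  simpa only [rightMul_one] using rightMul_mem_closedMul (τ := τ) hx hS

theorem rightMul_closedMul_mem {b : M} (hK : IsClosed (K : Set τ.L2))
    (h : ∀ x ∈ X, ∀ a ∈ S, τ.rightMul (a * b) x ∈ K) {ξ : τ.L2} (hξ : ξ ∈ τ.closedMul X S) :
    τ.rightMul b ξ ∈ K := by
  have hle : τ.closedMul X S ≤ K.comap (τ.rightMul b).toLinearMap :=
    closedMul_le (hK.preimage (τ.rightMul b).continuous) fun x hx a ha => by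
      change τ.rightMul b (τ.rightMul a x) ∈ K
      rw [rightMul_rightMul]
      exact h x hx a ha
  exact hle hξ

theorem mem_orthogonal_closedMul {v : τ.L2}
    (h : ∀ x ∈ X, ∀ a ∈ S, ⟪τ.rightMul a x, v⟫_ℂ = 0) : v ∈ (τ.closedMul X S)ᗮ := by
  have hle : τ.closedMul X S ≤ (ℂ ∙ v)ᗮ := closedMul_le (Submodule.isClosed_orthogonal _)
    fun x hx a ha => Submodule.mem_orthogonal_singleton_iff_inner_left.2 (h x hx a ha)
  exact fun w hw => Submodule.mem_orthogonal_singleton_iff_inner_left.1 (hle hw)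

theorem starMul_closedMul_eq_zero {ξ : τ.L2} (h : ∀ x ∈ X, τ.starMul ξ x = 0) :
    ∀ η ∈ τ.closedMul X S, τ.starMul ξ η = 0 := by
  refine closedMul_le (K := LinearMap.ker (τ.starMul ξ).toLinearMap)
    (τ.starMul ξ).isClosed_ker fun x hx a _ => τ.starMul_eq_zero_iff.2 fun b => ?_
  rw [rightMul_rightMul]
  exact τ.starMul_eq_zero_iff.1 (h x hx) _

theorem isColumnSum_pair (hX : Z ⊔ W = X) (h : ∀ z ∈ Z, ∀ w ∈ W, τ.starMul z w = 0) :
    τ.IsColumnSum X ![Z, W] where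
  le := Fin.forall_fin_two.2 ⟨hX ▸ le_sup_left, hX ▸ le_sup_right⟩
  dense := by
    rw [iSup_cons_pair, hX]
    exact Submodule.le_topologicalClosure _
  starMul_eq_zero := Fin.forall_fin_two.2
    ⟨Fin.forall_fin_two.2 ⟨fun h₀ => absurd rfl h₀, fun _ => h⟩,
      Fin.forall_fin_two.2 ⟨fun _ w hw z hz => τ.starMul_eq_zero_symm (h z hz w hw),
        fun h₁ => absurd rfl h₁⟩⟩

end ClosedMul

section Invariant

variable {H : Type*} [NormedAddCommGroup H] [InnerProductSpace ℂ H] [CompleteSpace H]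
  {M : VonNeumannAlgebra H} {τ : FaithfulTracialState M.Elem} {A D : Subalgebra ℂ M.Elem}
  {Φ : M.Elem →ₗ[ℂ] M.Elem} {K X Y : Submodule ℂ τ.L2}

theorem IsCondExp.starMul_closedMul_mem_L1Of (hΦ : τ.IsCondExp D Φ) {ξ : τ.L2}
    (h : ∀ x ∈ X, τ.starMul ξ x ∈ τ.L1Of D) : ∀ η ∈ τ.closedMul X D, τ.starMul ξ η ∈ τ.L1Of D := by
  refine closedMul_le (K := (τ.L1Of D).comap (τ.starMul ξ).toLinearMap)
    ((Submodule.isClosed_topologicalClosure _).preimage (τ.starMul ξ).continuous)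
    fun x hx d hd => hΦ.starMul_mem_L1Of_iff.2 fun b => ?_
  rw [rightMul_rightMul, rightMul_rightMul, hΦ.starMul_mem_L1Of_iff.1 (h x hx),
    hΦ.map_mul_left hd]

theorem IsInvariant.closedMul_le (hK : τ.IsInvariant A K) (hX : X ≤ K) : τ.closedMul X A ≤ K :=
  FaithfulTracialState.closedMul_le hK.isClosed fun x hx a ha => hK.rightMul_mem x (hX hx) a ha

theorem IsInvariant.closedMul_zeroPart_le (hK : τ.IsInvariant A K) :
    τ.closedMul K (τ.zeroPart A) ≤ K :=
  (closedMul_mono le_rfl fun _ ha => ha.1).trans (hK.closedMul_le le_rfl)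

theorem IsInvariant.sup (h : K ⟂ X) (hK : τ.IsInvariant A K) (hX : τ.IsInvariant A X) :
    τ.IsInvariant A (K ⊔ X) where
  isClosed := isClosed_sup_of_isOrtho h hK.isClosed hX.isClosed
  rightMul_mem x hx a ha := by
    obtain ⟨k, hk, y, hy, rfl⟩ := Submodule.mem_sup.1 hx
    rw [map_add]
    exact Submodule.add_mem_sup (hK.rightMul_mem k hk a ha) (hX.rightMul_mem y hy a ha)

theorem isInvariant_closedMul : τ.IsInvariant A (τ.closedMul Y A) where
  isClosed := isClosed_closedMul
  rightMul_mem _ hx _ ha := rightMul_closedMul_mem isClosed_closedMul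
    (fun _ hy _ hb => rightMul_mem_closedMul hy (A.mul_mem hb ha)) hx

theorem closedMul_closedMul_diag :
    τ.closedMul (τ.closedMul Y (diag A)) A = τ.closedMul Y A :=
  le_antisymm (isInvariant_closedMul.closedMul_le (closedMul_mono le_rfl diag_le))
    (closedMul_mono (le_closedMul (diag A).one_mem) subset_rfl)

theorem isDiagSubmodule_closedMul : τ.IsDiagSubmodule A (τ.closedMul Y (diag A)) :=
  fun _ hy _ hd => rightMul_closedMul_mem isClosed_closedMul
    (fun _ hx _ ha => rightMul_mem_closedMul hx ((diag A).mul_mem ha hd)) hy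

theorem IsDiagSubmodule.closedMul_eq (h : τ.IsDiagSubmodule A Y) (hY : IsClosed (Y : Set τ.L2)) :
    τ.closedMul Y (diag A) = Y :=
  le_antisymm (closedMul_le hY h) (le_closedMul (diag A).one_mem)

theorem IsTypeTwo.closedMul_zeroPart_eq (hK : τ.IsTypeTwo A K) :
    τ.closedMul K (τ.zeroPart A) = K := by
  have hsup : _ ⊔ τ.wandering A K = K :=
    sup_inf_orthogonal_of_isClosed isClosed_closedMul hK.toIsInvariant.closedMul_zeroPart_le
  rwa [hK.wandering_eq_bot, sup_bot_eq] at hsup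

theorem wandering_le : τ.wandering A X ≤ X := inf_le_left

theorem inner_rightMul_wandering {x y : τ.L2} {a : M.Elem} (hx : x ∈ X)
    (ha : a ∈ τ.zeroPart A) (hy : y ∈ τ.wandering A X) : ⟪τ.rightMul a x, y⟫_ℂ = 0 :=
  hy.2 _ (rightMul_mem_closedMul hx ha)

theorem HasMultiplicativeCondExp.inner_rightMul_diag_zeroPart (hA : τ.HasMultiplicativeCondExp A)
    {y x : τ.L2} (h : τ.starMul y x ∈ τ.L1Of (diag A)) {d a : M.Elem} (hd : d ∈ diag A)
    (ha : a ∈ τ.zeroPart A) : ⟪τ.rightMul d y, τ.rightMul a x⟫_ℂ = 0 := by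
  rw [inner_rightMul_left, rightMul_rightMul, hA.isCondExp.starMul_mem_L1Of_iff.1 h,
    hA.isCondExp.map_mul_right (hA.isCondExp.star_mem hd), LinearMap.mem_ker.1 ha.2, zero_mul,
    rightMul_zero, inner_zero_right]

end Invariant

/-! ### Uniqueness of decompositions -/

namespace IsDecomposition

variable {H : Type*} [NormedAddCommGroup H] [InnerProductSpace ℂ H] [CompleteSpace H]
  {M : VonNeumannAlgebra H} {τ : FaithfulTracialState M.Elem} {A : Subalgebra ℂ M.Elem}
  {X Y Z Y' Z' : Submodule ℂ τ.L2}

theorem left_isOrtho (h : τ.IsDecomposition A X Z Y) : Z ⟂ τ.closedMul Y A :=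
  Submodule.isOrtho_iff_inner_eq.2 fun z hz y hy => τ.inner_eq_zero_of_starMul_eq_zero
    (h.isColumnSum.starMul_eq_zero 0 1 (by decide) z hz y hy)

theorem eq_sup (h : τ.IsDecomposition A X Z Y) : X = Z ⊔ τ.closedMul Y A := by
  refine le_antisymm ?_ (sup_le h.left_le (h.isColumnSum.le 1))
  have hclosed : IsClosed ((Z ⊔ τ.closedMul Y A : Submodule ℂ τ.L2) : Set τ.L2) :=
    isClosed_sup_of_isOrtho h.left_isOrtho h.isTypeTwo.isClosed isClosed_closedMul
  simpa only [iSup_cons_pair, hclosed.submodule_topologicalClosure_eq] using h.isColumnSum.dense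

theorem isInvariant (h : τ.IsDecomposition A X Z Y) : τ.IsInvariant A X := by
  rw [h.eq_sup]
  exact .sup h.left_isOrtho h.isTypeTwo.toIsInvariant isInvariant_closedMul

theorem closedMul_diag_le (h : τ.IsDecomposition A X Z Y) : τ.closedMul Y (diag A) ≤ X :=
  (closedMul_mono le_rfl diag_le).trans (h.isColumnSum.le 1)

theorem isOrtho_closedMul_diag (h : τ.IsDecomposition A X Z Y)
    (hA : τ.HasMultiplicativeCondExp A) :
    τ.closedMul X (τ.zeroPart A) ⟂ τ.closedMul Y (diag A) := by
  refine closedMul_le (Submodule.isClosed_orthogonal _) fun x hx a ha => ?_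
  rw [h.eq_sup] at hx
  obtain ⟨z, hz, u, hu, rfl⟩ := Submodule.mem_sup.1 hx
  have hza : τ.rightMul a z ∈ (τ.closedMul Y (diag A))ᗮ :=
    Submodule.orthogonal_le (closedMul_mono le_rfl diag_le)
      (h.left_isOrtho.le (h.isTypeTwo.rightMul_mem z hz a ha.1))
  have hua : τ.rightMul a u ∈ (τ.closedMul Y (diag A))ᗮ :=
    rightMul_closedMul_mem (Submodule.isClosed_orthogonal _) (fun x hx b hb =>
      mem_orthogonal_closedMul fun y hy d hd => hA.inner_rightMul_diag_zeroPart
        (h.starMul_mem y hy x hx) hd (hA.mul_mem_zeroPart hb ha)) hu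
  rw [map_add]
  exact add_mem hza hua

theorem eq_closedMul_zeroPart_sup (h : τ.IsDecomposition A X Z Y)
    (hA : τ.HasMultiplicativeCondExp A) :
    X = τ.closedMul X (τ.zeroPart A) ⊔ τ.closedMul Y (diag A) := by
  refine le_antisymm ?_ (sup_le h.isInvariant.closedMul_zeroPart_le h.closedMul_diag_le)
  have hZ : Z ≤ τ.closedMul X (τ.zeroPart A) := by
    rw [← h.isTypeTwo.closedMul_zeroPart_eq]
    exact closedMul_mono h.left_le subset_rfl
  have hYA : τ.closedMul Y A ≤ τ.closedMul X (τ.zeroPart A) ⊔ τ.closedMul Y (diag A) := by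
    refine closedMul_le (isClosed_sup_of_isOrtho (h.isOrtho_closedMul_diag hA) isClosed_closedMul
      isClosed_closedMul) fun y hy a ha => ?_
    rw [← sub_add_cancel a (τ.condExp (diag A) a), rightMul_add]
    exact Submodule.add_mem_sup
      (rightMul_mem_closedMul (h.right_le hy) (hA.sub_condExp_mem_zeroPart ha))
      (rightMul_mem_closedMul hy (hA.isCondExp.map_mem a))
  exact h.eq_sup.trans_le (sup_le (hZ.trans le_sup_left) hYA)

theorem closedMul_diag_eq_wandering (h : τ.IsDecomposition A X Z Y)
    (hA : τ.HasMultiplicativeCondExp A) : τ.closedMul Y (diag A) = τ.wandering A X :=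
  (inf_orthogonal_eq_of_isOrtho_sup (h.isOrtho_closedMul_diag hA)
    (h.eq_closedMul_zeroPart_sup hA)).symm

theorem isSimplyInvariant_iff (h : τ.IsDecomposition A X Z Y)
    (hA : τ.HasMultiplicativeCondExp A) : τ.IsSimplyInvariant A X ↔ Y ≠ ⊥ := by
  refine ⟨?_, fun hY => ⟨h.isInvariant, h.isInvariant.closedMul_zeroPart_le.lt_of_ne
    fun heq => hY ?_⟩⟩
  · rintro hX rfl
    have heq := h.eq_closedMul_zeroPart_sup hA
    rw [closedMul_bot, sup_bot_eq] at heq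
    exact hX.lt.ne heq.symm
  · have hbot := h.closedMul_diag_eq_wandering hA
    rw [wandering, heq, Submodule.inf_orthogonal_eq_bot] at hbot
    exact le_bot_iff.1 (hbot ▸ le_closedMul (diag A).one_mem)

theorem closedMul_diag (h : τ.IsDecomposition A X Z Y) (hA : τ.HasMultiplicativeCondExp A) :
    τ.IsDecomposition A X Z (τ.closedMul Y (diag A)) where
  left_le := h.left_le
  right_le := h.closedMul_diag_le
  isClosed_right := isClosed_closedMul
  isTypeTwo := h.isTypeTwo
  starMul_mem ξ hξ := hA.isCondExp.starMul_closedMul_mem_L1Of fun y hy =>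
    hA.isCondExp.starMul_mem_L1Of_symm
      (hA.isCondExp.starMul_closedMul_mem_L1Of (h.starMul_mem y hy) ξ hξ)
  isColumnSum := by rw [closedMul_closedMul_diag]; exact h.isColumnSum

theorem closedMul_diag_unique (h : τ.IsDecomposition A X Z Y)
    (h' : τ.IsDecomposition A X Z' Y') (hA : τ.HasMultiplicativeCondExp A) :
    τ.closedMul Y (diag A) = τ.closedMul Y' (diag A) := by
  rw [h.closedMul_diag_eq_wandering hA, h'.closedMul_diag_eq_wandering hA]

theorem left_eq (h : τ.IsDecomposition A X Z Y) : Z = X ⊓ (τ.closedMul Y A)ᗮ :=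
  (inf_orthogonal_eq_of_isOrtho_sup h.left_isOrtho.symm (h.eq_sup.trans (sup_comm _ _))).symm

theorem left_unique (h : τ.IsDecomposition A X Z Y) (h' : τ.IsDecomposition A X Z' Y')
    (hA : τ.HasMultiplicativeCondExp A) : Z = Z' := by
  rw [h.left_eq, h'.left_eq, ← closedMul_closedMul_diag, h.closedMul_diag_unique h' hA,
    closedMul_closedMul_diag]

theorem right_unique (h : τ.IsDecomposition A X Z Y) (h' : τ.IsDecomposition A X Z' Y')
    (hA : τ.HasMultiplicativeCondExp A) (hY : τ.IsDiagSubmodule A Y)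
    (hY' : τ.IsDiagSubmodule A Y') : Y = Y' := by
  rw [← hY.closedMul_eq h.isClosed_right, ← hY'.closedMul_eq h'.isClosed_right]
  exact h.closedMul_diag_unique h' hA

end IsDecomposition

/-! ### Existence of decompositions -/

section Subdiagonal

variable {H : Type*} [NormedAddCommGroup H] [InnerProductSpace ℂ H] [CompleteSpace H]
  {M : VonNeumannAlgebra H} {τ : FaithfulTracialState M.Elem} {A : Subalgebra ℂ M.Elem}
  {X : Submodule ℂ τ.L2}

variable (τ A) in
/-- Arveson's subdiagonal algebras, with respect to the trace preserving conditional expectation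
onto `A ∩ A⋆`: they need not be weak⋆ closed. -/
structure IsSubdiagonal : Prop where
  hasMultiplicativeCondExp : τ.HasMultiplicativeCondExp A
  dense : @Dense _ M.weakStar {x : M.Elem | ∃ a ∈ A, ∃ b ∈ A, x = a + star b}

variable (τ A X) in
/-- The type 2 part of an invariant subspace `X`: what remains of `X` after the invariant subspace
generated by its wandering subspace has been split off. -/
def typeTwoPart : Submodule ℂ τ.L2 := X ⊓ (τ.closedMul (τ.wandering A X) A)ᗮ

theorem typeTwoPart_le : τ.typeTwoPart A X ≤ X := inf_le_left

theorem inner_rightMul_typeTwoPart {a : M.Elem} {z y : τ.L2} (hz : z ∈ τ.typeTwoPart A X)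
    (hy : y ∈ τ.wandering A X) (ha : a ∈ A) : ⟪z, τ.rightMul a y⟫_ℂ = 0 :=
  Submodule.inner_left_of_mem_orthogonal (rightMul_mem_closedMul hy ha) hz.2

theorem IsInvariant.typeTwoPart_sup_closedMul_wandering (hX : τ.IsInvariant A X) :
    τ.typeTwoPart A X ⊔ τ.closedMul (τ.wandering A X) A = X := by
  rw [sup_comm]
  exact sup_inf_orthogonal_of_isClosed isClosed_closedMul (hX.closedMul_le wandering_le)

theorem IsInvariant.wandering_typeTwoPart_eq_bot (hX : τ.IsInvariant A X) :
    τ.wandering A (τ.typeTwoPart A X) = ⊥ := by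
  refine (Submodule.eq_bot_iff _).2 fun w hw => ?_
  have hwX : w ∈ τ.wandering A X := by
    refine ⟨hw.1.1, mem_orthogonal_closedMul fun x hx a ha => ?_⟩
    rw [← hX.typeTwoPart_sup_closedMul_wandering] at hx
    obtain ⟨z, hz, u, hu, rfl⟩ := Submodule.mem_sup.1 hx
    rw [map_add, inner_add_left, inner_rightMul_wandering hz ha hw,
      hw.1.2 _ (isInvariant_closedMul.rightMul_mem u hu a ha.1), add_zero]
  exact inner_self_eq_zero.1 (hw.1.2 w (le_closedMul A.one_mem hwX))

namespace IsSubdiagonal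

theorem starMul_mem_L1Of (hA : τ.IsSubdiagonal A) (hτ : τ.IsNormal) {ξ η : τ.L2}
    (hξη : ∀ a ∈ τ.zeroPart A, ⟪ξ, τ.rightMul a η⟫_ℂ = 0)
    (hηξ : ∀ a ∈ τ.zeroPart A, ⟪τ.rightMul a ξ, η⟫_ℂ = 0) :
    τ.starMul ξ η ∈ τ.L1Of (diag A) := by
  let _ := M.weakStar
  have hA' := hA.hasMultiplicativeCondExp
  have hcont := hτ.continuous_inner_rightMul ξ η
  refine hA'.isCondExp.starMul_mem_L1Of_iff.2 (congrFun
    (Continuous.ext_on hA.dense hcont (hcont.comp hA'.isCondExp.normal) ?_))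
  rintro _ ⟨a, ha, b, hb, rfl⟩
  set Φ := τ.condExp (diag A)
  have hdecomp : a + star b = (a - Φ a) + star (b - Φ b) + Φ (a + star b) := by
    rw [map_add, hA'.isCondExp.map_star, star_sub]
    abel
  calc ⟪ξ, τ.rightMul (a + star b) η⟫_ℂ
      = ⟪ξ, τ.rightMul (a - Φ a) η⟫_ℂ + ⟪τ.rightMul (b - Φ b) ξ, η⟫_ℂ +
          ⟪ξ, τ.rightMul (Φ (a + star b)) η⟫_ℂ := by
        conv_lhs => rw [hdecomp]
        rw [rightMul_add, rightMul_add, inner_add_right, inner_add_right, inner_rightMul_left]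
    _ = ⟪ξ, τ.rightMul (Φ (a + star b)) η⟫_ℂ := by
        rw [hξη _ (hA'.sub_condExp_mem_zeroPart ha), hηξ _ (hA'.sub_condExp_mem_zeroPart hb),
          zero_add, zero_add]

theorem starMul_wandering_mem_L1Of (hA : τ.IsSubdiagonal A) (hτ : τ.IsNormal) {x y : τ.L2}
    (hx : x ∈ τ.wandering A X) (hy : y ∈ τ.wandering A X) :
    τ.starMul y x ∈ τ.L1Of (diag A) :=
  hA.starMul_mem_L1Of hτ
    (fun _ ha => inner_eq_zero_symm.1 (inner_rightMul_wandering (wandering_le hx) ha hy))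
    fun _ ha => inner_rightMul_wandering (wandering_le hy) ha hx

theorem starMul_typeTwoPart_wandering (hA : τ.IsSubdiagonal A) (hτ : τ.IsNormal) {z y : τ.L2}
    (hz : z ∈ τ.typeTwoPart A X) (hy : y ∈ τ.wandering A X) : τ.starMul z y = 0 := by
  have hΦ := hA.hasMultiplicativeCondExp.isCondExp
  have hL1 : τ.starMul z y ∈ τ.L1Of (diag A) := hA.starMul_mem_L1Of hτ
    (fun a ha => inner_rightMul_typeTwoPart hz hy ha.1)
    fun a ha => inner_rightMul_wandering (typeTwoPart_le hz) ha hy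
  refine τ.starMul_eq_zero_iff.2 fun b => ?_
  rw [hΦ.starMul_mem_L1Of_iff.1 hL1, inner_rightMul_typeTwoPart hz hy (diag_le (hΦ.map_mem b))]

theorem starMul_typeTwoPart_closedMul_wandering (hA : τ.IsSubdiagonal A) (hτ : τ.IsNormal) :
    ∀ z ∈ τ.typeTwoPart A X, ∀ y ∈ τ.closedMul (τ.wandering A X) A, τ.starMul z y = 0 :=
  fun _ hz => starMul_closedMul_eq_zero fun _ => hA.starMul_typeTwoPart_wandering hτ hz

theorem isInvariant_typeTwoPart (hA : τ.IsSubdiagonal A) (hτ : τ.IsNormal)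
    (hX : τ.IsInvariant A X) : τ.IsInvariant A (τ.typeTwoPart A X) where
  isClosed := hX.isClosed.inter (Submodule.isClosed_orthogonal _)
  rightMul_mem z hz a ha := ⟨hX.rightMul_mem z hz.1 a ha, fun y hy =>
    τ.starMul_eq_zero_iff.1 (τ.starMul_eq_zero_symm
      (hA.starMul_typeTwoPart_closedMul_wandering hτ z hz y hy)) a⟩

theorem isDecomposition (hA : τ.IsSubdiagonal A) (hτ : τ.IsNormal) (hX : τ.IsInvariant A X) :
    τ.IsDecomposition A X (τ.typeTwoPart A X) (τ.wandering A X) where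
  left_le := typeTwoPart_le
  right_le := wandering_le
  isClosed_right := hX.isClosed.inter (Submodule.isClosed_orthogonal _)
  isTypeTwo := ⟨hA.isInvariant_typeTwoPart hτ hX, hX.wandering_typeTwoPart_eq_bot⟩
  starMul_mem _ hy _ hx := hA.starMul_wandering_mem_L1Of hτ hx hy
  isColumnSum := isColumnSum_pair hX.typeTwoPart_sup_closedMul_wandering
    (hA.starMul_typeTwoPart_closedMul_wandering hτ)

end IsSubdiagonal

end Subdiagonal

end FaithfulTracialState

end

theorem theorem2p1_general {H : Type*} [NormedAddCommGroup H] [InnerProductSpace ℂ H]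
    [CompleteSpace H] (M : VonNeumannAlgebra H) (τ : FaithfulTracialState M.Elem)
    (A : Subalgebra ℂ M.Elem) (hA : τ.HasMultiplicativeCondExp A) :
    (∀ X Z Y : Submodule ℂ τ.L2, τ.IsDecomposition A X Z Y →
      (τ.IsSimplyInvariant A X ↔ Y ≠ ⊥) ∧
      (τ.closedMul Y (FaithfulTracialState.diag A) =
          X ⊓ (τ.closedMul X (τ.zeroPart A))ᗮ ∧
        X = τ.closedMul X (τ.zeroPart A) ⊔ τ.closedMul Y (FaithfulTracialState.diag A) ∧
        τ.closedMul X (τ.zeroPart A) ⟂ τ.closedMul Y (FaithfulTracialState.diag A)) ∧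
      (τ.IsDecomposition A X Z (τ.closedMul Y (FaithfulTracialState.diag A)) ∧
        τ.IsDiagSubmodule A (τ.closedMul Y (FaithfulTracialState.diag A)))) ∧
    (∀ X Z Y Z' Y' : Submodule ℂ τ.L2,
      τ.IsDecomposition A X Z Y → τ.IsDecomposition A X Z' Y' →
      Z = Z' ∧
      τ.closedMul Y (FaithfulTracialState.diag A) =
        τ.closedMul Y' (FaithfulTracialState.diag A) ∧
      (τ.IsDiagSubmodule A Y → τ.IsDiagSubmodule A Y' → Y = Y')) ∧
    (τ.IsNormal → τ.IsSubdiagonal A → ∀ X : Submodule ℂ τ.L2, τ.IsInvariant A X →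
      ∃ Z : Submodule ℂ τ.L2, τ.IsDecomposition A X Z (τ.wandering A X)) :=
  ⟨fun _ _ _ h => ⟨h.isSimplyInvariant_iff hA,
      ⟨h.closedMul_diag_eq_wandering hA, h.eq_closedMul_zeroPart_sup hA,
        h.isOrtho_closedMul_diag hA⟩,
      h.closedMul_diag hA, FaithfulTracialState.isDiagSubmodule_closedMul⟩,
    fun _ _ _ _ _ h h' => ⟨h.left_unique h' hA, h.closedMul_diag_unique h' hA,
      h.right_unique h' hA⟩,
    fun hτ hsub X hX => ⟨τ.typeTwoPart A X, hsub.isDecomposition hτ hX⟩⟩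

theorem theorem2p1 {H : Type*} [NormedAddCommGroup H] [InnerProductSpace ℂ H] [CompleteSpace H]
    (M : VonNeumannAlgebra H) (τ : FaithfulTracialState M.Elem) (hτ : τ.IsNormal)
    (A : Subalgebra ℂ M.Elem) (hA : τ.IsTracialSubalgebra A) :
    (∀ X Z Y : Submodule ℂ τ.L2, τ.IsDecomposition A X Z Y →
      (τ.IsSimplyInvariant A X ↔ Y ≠ ⊥) ∧
      (τ.closedMul Y (FaithfulTracialState.diag A) =
          X ⊓ (τ.closedMul X (τ.zeroPart A))ᗮ ∧
        X = τ.closedMul X (τ.zeroPart A) ⊔ τ.closedMul Y (FaithfulTracialState.diag A) ∧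
        τ.closedMul X (τ.zeroPart A) ⟂ τ.closedMul Y (FaithfulTracialState.diag A)) ∧
      (τ.IsDecomposition A X Z (τ.closedMul Y (FaithfulTracialState.diag A)) ∧
        τ.IsDiagSubmodule A (τ.closedMul Y (FaithfulTracialState.diag A)))) ∧
    (∀ X Z Y Z' Y' : Submodule ℂ τ.L2,
      τ.IsDecomposition A X Z Y → τ.IsDecomposition A X Z' Y' →
      Z = Z' ∧
      τ.closedMul Y (FaithfulTracialState.diag A) =
        τ.closedMul Y' (FaithfulTracialState.diag A) ∧
      (τ.IsDiagSubmodule A Y → τ.IsDiagSubmodule A Y' → Y = Y')) ∧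
    (τ.IsMaximalSubdiagonal A → ∀ X : Submodule ℂ τ.L2, τ.IsInvariant A X →
      ∃ Z : Submodule ℂ τ.L2, τ.IsDecomposition A X Z (τ.wandering A X)) := by
  obtain ⟨h₁, h₂, h₃⟩ := theorem2p1_general M τ A hA.exists_condExp_map_mul
  exact ⟨h₁, h₂, fun hmax => h₃ hτ ⟨hA.exists_condExp_map_mul, hmax.dense⟩⟩
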